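/- Let $n,m,k$ be positive integers, $f:\mathbb{R}^n\to\mathbb{R}^m$ a Lebesgue measurable function and $N\subseteq\mathbb{R}^n$ an arbitrary subset. Notation. For $\varphi:\mathbb{R}^n\to\mathbb{R}$, defined up to a null set, $\operatorname{ap\,lim}_{y\to x}\varphi(y)=l$ means that for every $\varepsilon>0$ the set $\{y:|\varphi(y)-l|\ge\varepsilon\}$ has density zero at $x$, and $\operatorname{ap\,limsup}_{y\to x}\varphi(y)$ is the infimum of all $\lambda\in\mathbb{R}$ such that $\{y:\varphi(y)\ge\lambda\}$ has density zero at $x$; here $S$ has density zero at $x$ if $\mathcal{L}^n(B(x,r)\cap S)/\mathcal{L}^n(B(x,r))\to0$ as $r\to0^+$ ($\mathcal L^n$ is the outer Lebesgue measure). A polynomial of degree at most $d$ centered at $x$ is a function $p_d(x;y)=\sum_{|\alpha|\le d}\frac{p_\alpha(x)}{\alpha!}(y-x)^\alpha$ with $p_\alpha(x)\in\mathbb{R}^m$. For an integer $d\ge 0$ and $t\in(0,1]$, $C^{d,t}(\mathbb{R}^n;\mathbb{R}^m)$ is the class of $C^d$ functions $g$ such that for every $|\alpha|\le d$ there is a constant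 $C$ with $|D^\alpha g(y)-D^\alpha g(z)|\le C|y-z|^t$ for all $y,z\in\mathbb{R}^n$. (A) Consider the following statements. (i) For every $x\in\mathbb{R}^n\setminus N$, $f$ is approximately differentiable of order $k$ at $x$: there is a polynomial $p_k(x;y)$ of degree at most $k$ centered at $x$ with $\operatorname{ap\,lim}_{y\to x}\frac{|f(y)-p_k(x;y)|}{|y-x|^k}=0$. (ii) For every $x\in\mathbb{R}^n\setminus N$, $f$ has an approximate $(k-1)$-Taylor polynomial at $x$: there is a polynomial $p_{k-1}(x;y)$ of degree at most $k-1$ centered at $x$ with $\operatorname{ap\,limsup}_{y\to x}\frac{|f(y)-p_{k-1}(x;y)|}{|y-x|^k}<+\infty$. (iii) There are sets $B_j$, $j\in\mathbb{N}$, with $\mathbb{R}^n\setminus N=\bigcup_{j}B_j$, and functions $g_j\in C^{k-1,1}(\mathbb{R}^n;\mathbb{R}^m)$, such that at each $x\in B_j$ the function $f$ has an approximate $(k-1)$-Taylor polynomial, and the coefficients $f_\alpha(x)$ of every such polynomial $\sum_{|\alpha|\le k-1}\frac{f_\alpha(x)}{\alpha!}(y-x)^\alpha$ satisfy $f_\alpha(x)=D^\alpha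 g_j(x)$ for all $|\alpha|\le k-1$. (In particular this polynomial is unique.) Then (i) $\Rightarrow$ (ii) $\Rightarrow$ (iii). (B) Let $t\in(0,1]$ and suppose that for every $x\in\mathbb{R}^n\setminus N$ there is a polynomial $p_{k-1}(x;y)$ of degree at most $k-1$ centered at $x$ with $$\operatorname{ap\,limsup}_{y\to x}\frac{|f(y)-p_{k-1}(x;y)|}{|y-x|^{k-1+t}}<+\infty.$$ Then there are sets $B_j$, $j\in\mathbb{N}$, with $\mathbb{R}^n\setminus N=\bigcup_jB_j$, and functions $g_j\in C^{k-1,t}(\mathbb{R}^n;\mathbb{R}^m)$, such that for every $x\in B_j$ the coefficients $f_\alpha(x)$ of every polynomial $\sum_{|\alpha|\le k-1}\frac{f_\alpha(x)}{\alpha!}(y-x)^\alpha$ with this property satisfy $f_\alpha(x)=D^\alpha g_j(x)$ for all $|\alpha|\le k-1$. -/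

import Mathlib

open MeasureTheory Filter Topology Finset

noncomputable section

/-- The set `S ⊆ ℝⁿ` has Lebesgue (outer) density zero at `x`:
`𝓛ⁿ(B(x,r) ∩ S) / 𝓛ⁿ(B(x,r)) → 0` as `r → 0⁺`. -/
def HasDensityZeroAt {n : ℕ} (S : Set (EuclideanSpace ℝ (Fin n)))
    (x : EuclideanSpace ℝ (Fin n)) : Prop :=
  Tendsto (fun r : ℝ => volume (Metric.ball x r ∩ S) / volume (Metric.ball x r))
    (𝓝[>] 0) (𝓝 0)

/-- `ap lim_{y → x} φ(y) = l`. -/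
def HasApLim {n : ℕ} (φ : EuclideanSpace ℝ (Fin n) → ℝ)
    (x : EuclideanSpace ℝ (Fin n)) (l : ℝ) : Prop :=
  ∀ ε : ℝ, 0 < ε → HasDensityZeroAt {y | ε ≤ |φ y - l|} x

/-- `ap limsup_{y → x} φ(y)`: the infimum, in the extended reals, of all real `lam` such that
`{y | φ y ≥ lam}` has density zero at `x` (so it is `+∞` if there is no such `lam`). -/
def apLimsup {n : ℕ} (φ : EuclideanSpace ℝ (Fin n) → ℝ)
    (x : EuclideanSpace ℝ (Fin n)) : EReal :=
  sInf {L : EReal | ∃ lam : ℝ, L = (lam : EReal) ∧ HasDensityZeroAt {y | lam ≤ φ y} x}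

/-- The polynomial of degree at most `d` centered at `x` with coefficients `c α`, `|α| ≤ d`:
`p(x;y) = ∑_{|α| ≤ d} (c α / α!) (y - x)^α`.  Only the values `c α` with `|α| ≤ d` matter;
`piAntidiag univ i` is the finite set of the multi-indices `α` with `|α| = i`. -/
def centeredPoly {n m : ℕ} (d : ℕ) (c : (Fin n → ℕ) → EuclideanSpace ℝ (Fin m))
    (x y : EuclideanSpace ℝ (Fin n)) : EuclideanSpace ℝ (Fin m) :=
  ∑ i ∈ range (d + 1), ∑ α ∈ piAntidiag (univ : Finset (Fin n)) i,
    ((∏ j, (y j - x j) ^ α j) / ∏ j, ((α j).factorial : ℝ)) • c α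

/-- `f` is approximately differentiable of order `k` at `x`. -/
def ApproxDifferentiableAt {n m : ℕ}
    (f : EuclideanSpace ℝ (Fin n) → EuclideanSpace ℝ (Fin m)) (k : ℕ)
    (x : EuclideanSpace ℝ (Fin n)) : Prop :=
  ∃ c : (Fin n → ℕ) → EuclideanSpace ℝ (Fin m),
    HasApLim (fun y => ‖f y - centeredPoly k c x y‖ / ‖y - x‖ ^ k) x 0

/-- The polynomial of degree at most `d` centered at `x` with coefficients `c` satisfies
`ap limsup_{y → x} |f(y) - p(x;y)| / |y - x|^s < +∞`. -/
def IsApproxTaylorPoly {n m : ℕ}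
    (f : EuclideanSpace ℝ (Fin n) → EuclideanSpace ℝ (Fin m)) (d : ℕ) (s : ℝ)
    (x : EuclideanSpace ℝ (Fin n)) (c : (Fin n → ℕ) → EuclideanSpace ℝ (Fin m)) : Prop :=
  apLimsup (fun y => ‖f y - centeredPoly d c x y‖ / ‖y - x‖ ^ s) x < ⊤

/-- `∂g/∂x_i`. -/
def partialDeriv {n m : ℕ} (i : Fin n)
    (g : EuclideanSpace ℝ (Fin n) → EuclideanSpace ℝ (Fin m)) :
    EuclideanSpace ℝ (Fin n) → EuclideanSpace ℝ (Fin m) :=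
  fun x => lineDeriv ℝ g x (EuclideanSpace.single i 1)

/-- `D^α g = ∂₁^{α₁} ⋯ ∂ₙ^{αₙ} g`. -/
def multiDeriv {n m : ℕ} (α : Fin n → ℕ)
    (g : EuclideanSpace ℝ (Fin n) → EuclideanSpace ℝ (Fin m)) :
    EuclideanSpace ℝ (Fin n) → EuclideanSpace ℝ (Fin m) :=
  (List.finRange n).foldr (fun i h => (partialDeriv i)^[α i] h) g

/-- `g ∈ C^{d,t}(ℝⁿ; ℝᵐ)`: `g` is of class `C^d` and its partial derivatives of all orders
`≤ d` (including `g` itself) are globally `t`-Hölder continuous on `ℝⁿ`. -/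
def IsCHolder {n m : ℕ} (d : ℕ) (t : ℝ)
    (g : EuclideanSpace ℝ (Fin n) → EuclideanSpace ℝ (Fin m)) : Prop :=
  ContDiff ℝ d g ∧ ∀ α : Fin n → ℕ, ∑ i, α i ≤ d →
    ∃ C : ℝ, ∀ y z, ‖multiDeriv α g y - multiDeriv α g z‖ ≤ C * ‖y - z‖ ^ t

/-- `ℝⁿ ∖ N` is a countable union of sets `B_j`, each carrying a function
`g_j ∈ C^{d,t}(ℝⁿ; ℝᵐ)` with `f_α(x) = D^α g_j(x)` for all `x ∈ B_j` and `|α| ≤ d`.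
Here the `f_α(x)` are the coefficients of the approximate Taylor polynomial of degree at most `d`
of `f` at `x` (with exponent `s`): such a polynomial exists at each `x ∈ B_j`,
and the identity holds for every such polynomial. -/
def HasHolderDecomposition {n m : ℕ}
    (f : EuclideanSpace ℝ (Fin n) → EuclideanSpace ℝ (Fin m)) (d : ℕ) (s t : ℝ)
    (N : Set (EuclideanSpace ℝ (Fin n))) : Prop :=
  ∃ (B : ℕ → Set (EuclideanSpace ℝ (Fin n)))
    (g : ℕ → EuclideanSpace ℝ (Fin n) → EuclideanSpace ℝ (Fin m)),
    (⋃ j, B j) = Nᶜ ∧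
    ∀ j, IsCHolder d t (g j) ∧
      ∀ x ∈ B j,
        (∃ c, IsApproxTaylorPoly f d s x c) ∧
        ∀ c, IsApproxTaylorPoly f d s x c →
          ∀ α : Fin n → ℕ, ∑ i, α i ≤ d → c α = multiDeriv α (g j) x

end

/-! Write `s = d + t`. Suppose polynomials of degree at most `d` approximate `f` to order `s` near
`x` and near `z`, each off a set of small density, and let `r = |x - z|`. On most of `B(x, r)` both
are within a multiple of `r ^ s` of `f`, hence of each other. A polynomial that is small on most of
a ball has small coefficients (`exists_coeff_bound`: compactness of the normalized jets, then
scaling). This gives `exists_two_point_bound`. With `z = x` and `r → 0` it yields uniqueness of the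
coefficients (`IsApproxTaylorPoly.coeff_eq`).

The complement of `N` is a countable union of pieces of small diameter on which the coefficients,
the approximation constant and the admissible radii are uniform. On a piece, the two-point bound
becomes Whitney's condition `|P_x(y) - P_z(y)| ≤ W (|y - x| + |y - z|) ^ s` for all `y`, and a
Whitney extension of the field `P` is the required function in `C^{d,t}`. This proves (B). The
implication (ii) ⇒ (iii) is its case `t = 1`, and (i) ⇒ (ii) amounts to dropping the terms of degree
`k`.

The extension theorem (`exists_whitney_extension`) is proved without estimating derivatives. The
regularity carried along is `JetApprox`, a uniform polynomial approximation of order `s` at every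
point, which is stable under sums and rescaling. The partition of unity comes from telescoping
dyadic cutoffs of `E`: its members are, up to a factor of absolute value at most one, rescaled
copies of finitely many kernels, and no normalizing division is needed. At the end a converse of
Taylor's theorem (`multiDeriv_eq_coeff`, `isCHolder_of_forall_approx`) identifies the coefficients
of the approximating polynomials with the partial derivatives and shows that these are Hölder
continuous. -/

noncomputable section

/-! ### Multi-indices, monomials and jets -/

/-- The finite set of multi-indices of total degree at most `d`. -/
def multiIdx (n d : ℕ) : Finset (Fin n → ℕ) :=
  (Fintype.piFinset fun _ => range (d + 1)).filter fun α => ∑ i, α i ≤ d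

theorem mem_multiIdx {n d : ℕ} {α : Fin n → ℕ} : α ∈ multiIdx n d ↔ ∑ i, α i ≤ d := by
  simp only [multiIdx, mem_filter, Fintype.mem_piFinset, mem_range, and_iff_right_iff_imp]
  intro h i
  exact Nat.lt_succ_of_le ((single_le_sum (fun _ _ => Nat.zero_le _) (mem_univ i)).trans h)

/-- The normalized monomial `v ^ α / α!`. -/
def mono {n : ℕ} (α : Fin n → ℕ) (v : EuclideanSpace ℝ (Fin n)) : ℝ :=
  ∏ j, v j ^ α j / ((α j).factorial : ℝ)

/-- The value at displacement `v` of the polynomial of degree at most `d` with coefficients `c`. -/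
def jetEval {n : ℕ} {F : Type*} [AddCommGroup F] [Module ℝ F] (d : ℕ)
    (c : (Fin n → ℕ) → F) (v : EuclideanSpace ℝ (Fin n)) : F :=
  ∑ α ∈ multiIdx n d, mono α v • c α

theorem centeredPoly_eq_jetEval {n m : ℕ} (d : ℕ) (c : (Fin n → ℕ) → EuclideanSpace ℝ (Fin m))
    (x y : EuclideanSpace ℝ (Fin n)) : centeredPoly d c x y = jetEval d c (y - x) := by
  unfold centeredPoly jetEval
  rw [← sum_fiberwise_of_maps_to (s := multiIdx n d) (t := range (d + 1))
    (g := fun α => ∑ i, α i)]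
  · refine sum_congr rfl fun i hi => ?_
    have : piAntidiag (univ : Finset (Fin n)) i
        = {α ∈ multiIdx n d | ∑ j, α j = i} := by
      ext α
      simp only [mem_piAntidiag, mem_univ, implies_true, and_true, mem_filter, mem_multiIdx]
      constructor
      · intro h
        have := mem_range.1 hi
        exact ⟨h.le.trans (by omega), h⟩
      · exact fun h => h.2
    rw [this]
    refine sum_congr rfl fun α _ => ?_
    simp only [mono, prod_div_distrib, PiLp.sub_apply]
  · intro α hα
    exact mem_range.2 (Nat.lt_succ_of_le (mem_multiIdx.1 hα))

section Mono

variable {n : ℕ}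

theorem mono_zero_left (v : EuclideanSpace ℝ (Fin n)) : mono 0 v = 1 := by
  simp [mono]

theorem mono_zero_right {α : Fin n → ℕ} (hα : α ≠ 0) :
    mono α (0 : EuclideanSpace ℝ (Fin n)) = 0 := by
  obtain ⟨i, hi⟩ := Function.ne_iff.1 hα
  exact prod_eq_zero (mem_univ i) (by simp [show α i ≠ 0 from hi])

theorem mono_single (i : Fin n) (v : EuclideanSpace ℝ (Fin n)) :
    mono (Pi.single i 1) v = v i := by
  unfold mono
  rw [prod_eq_single i]
  · simp
  · intro j _ hj
    simp [Pi.single_eq_of_ne hj]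
  · simp

theorem mono_smul (α : Fin n → ℕ) (r : ℝ) (v : EuclideanSpace ℝ (Fin n)) :
    mono α (r • v) = r ^ (∑ i, α i) * mono α v := by
  simp only [mono, PiLp.smul_apply, smul_eq_mul, mul_pow, mul_div_assoc, prod_mul_distrib,
    prod_pow_eq_pow_sum]

theorem abs_mono_le (α : Fin n → ℕ) (v : EuclideanSpace ℝ (Fin n)) :
    |mono α v| ≤ ‖v‖ ^ (∑ i, α i) := by
  unfold mono
  rw [abs_prod, ← prod_pow_eq_pow_sum]
  refine prod_le_prod (fun _ _ => abs_nonneg _) fun j _ => ?_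
  rw [abs_div, abs_pow, Nat.abs_cast]
  have h1 : |v j| ^ α j ≤ ‖v‖ ^ α j :=
    pow_le_pow_left₀ (abs_nonneg _) (PiLp.norm_apply_le v j) _
  exact (div_le_self (by positivity)
    (by exact_mod_cast Nat.one_le_iff_ne_zero.2 (Nat.factorial_ne_zero _))).trans h1

theorem continuous_mono (α : Fin n → ℕ) : Continuous (mono α) := by
  unfold mono
  fun_prop

theorem mono_add (α : Fin n → ℕ) (v w : EuclideanSpace ℝ (Fin n)) :
    mono α (v + w) = ∑ p ∈ Fintype.piFinset fun j => antidiagonal (α j),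
      mono (fun j => (p j).1) v * mono (fun j => (p j).2) w := by
  have h1 : ∀ (a : ℕ) (s t : ℝ), (s + t) ^ a / (a.factorial : ℝ) = ∑ p ∈ antidiagonal a,
      s ^ p.1 / (p.1.factorial : ℝ) * (t ^ p.2 / (p.2.factorial : ℝ)) := by
    intro a s t
    rw [(Commute.all s t).add_pow', sum_div]
    refine sum_congr rfl fun p hp => ?_
    have hp' := mem_antidiagonal.1 hp
    subst hp'
    have h2 := Nat.add_choose_mul_factorial_mul_factorial p.1 p.2
    have h3 : ((p.1 + p.2).choose p.1 : ℝ) * p.1.factorial * p.2.factorial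
        = (p.1 + p.2).factorial := by
      rw [Nat.choose_symm_add]
      exact_mod_cast h2
    rw [nsmul_eq_mul, ← h3]
    have := Nat.factorial_ne_zero p.1
    have := Nat.factorial_ne_zero p.2
    have : ((p.1 + p.2).choose p.1 : ℝ) ≠ 0 := by
      exact_mod_cast (Nat.choose_pos (Nat.le_add_right _ _)).ne'
    field_simp
  simp only [mono, PiLp.add_apply, h1]
  rw [prod_univ_sum]
  simp only [prod_mul_distrib]

end Mono

section Jet

variable {n : ℕ} {F : Type*} [NormedAddCommGroup F] [NormedSpace ℝ F]

theorem jetEval_smul_vec (d : ℕ) (c : (Fin n → ℕ) → F) (r : ℝ) (v : EuclideanSpace ℝ (Fin n)) :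
    jetEval d c (r • v) = jetEval d (fun α => r ^ (∑ i, α i) • c α) v := by
  unfold jetEval
  refine sum_congr rfl fun α _ => ?_
  rw [mono_smul, smul_smul, mul_comm]

theorem jetEval_sub (d : ℕ) (c c' : (Fin n → ℕ) → F) (v : EuclideanSpace ℝ (Fin n)) :
    jetEval d (c - c') v = jetEval d c v - jetEval d c' v := by
  simp [jetEval, smul_sub]

theorem jetEval_add (d : ℕ) (c c' : (Fin n → ℕ) → F) (v : EuclideanSpace ℝ (Fin n)) :
    jetEval d (c + c') v = jetEval d c v + jetEval d c' v := by
  simp [jetEval, smul_add, sum_add_distrib]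

theorem jetEval_const_smul (d : ℕ) (c : (Fin n → ℕ) → F) (r : ℝ)
    (v : EuclideanSpace ℝ (Fin n)) : jetEval d (r • c) v = r • jetEval d c v := by
  simp only [jetEval, smul_sum, Pi.smul_apply]
  exact sum_congr rfl fun α _ => smul_comm _ _ _

theorem jetEval_zero (d : ℕ) (v : EuclideanSpace ℝ (Fin n)) :
    jetEval d (0 : (Fin n → ℕ) → F) v = 0 := by
  simp [jetEval]

theorem jetEval_congr {d : ℕ} {c c' : (Fin n → ℕ) → F}
    (h : ∀ α : Fin n → ℕ, ∑ i, α i ≤ d → c α = c' α) (v : EuclideanSpace ℝ (Fin n)) :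
    jetEval d c v = jetEval d c' v :=
  sum_congr rfl fun α hα => by rw [h α (mem_multiIdx.1 hα)]

theorem jetEval_zero_vec (d : ℕ) (c : (Fin n → ℕ) → F) :
    jetEval d c (0 : EuclideanSpace ℝ (Fin n)) = c 0 := by
  unfold jetEval
  rw [sum_eq_single 0]
  · simp [mono_zero_left]
  · intro α _ hα
    simp [mono_zero_right hα]
  · intro h
    exact absurd (mem_multiIdx.2 (by simp)) h

theorem norm_jetEval_le (d : ℕ) (c : (Fin n → ℕ) → F) (v : EuclideanSpace ℝ (Fin n)) :
    ‖jetEval d c v‖ ≤ ∑ α ∈ multiIdx n d, ‖v‖ ^ (∑ i, α i) * ‖c α‖ := by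
  refine (norm_sum_le _ _).trans (sum_le_sum fun α _ => ?_)
  rw [norm_smul]
  exact mul_le_mul_of_nonneg_right (abs_mono_le α v) (norm_nonneg _)

/-- A jet whose coefficients are bounded at scale `r` by `M` is bounded on larger scales. -/
theorem norm_jetEval_le_of_coeff {d : ℕ} {c : (Fin n → ℕ) → F} {v : EuclideanSpace ℝ (Fin n)}
    {r R M : ℝ} (hr : 0 < r) (hrR : r ≤ R) (hv : ‖v‖ ≤ R)
    (hc : ∀ α : Fin n → ℕ, ∑ i, α i ≤ d → ‖c α‖ * r ^ (∑ i, α i) ≤ M) :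
    ‖jetEval d c v‖ ≤ (multiIdx n d).card * ((R / r) ^ d * M) := by
  refine (norm_jetEval_le d c v).trans ?_
  rw [← nsmul_eq_mul]
  refine sum_le_card_nsmul _ _ _ fun α hα => ?_
  have hα' := mem_multiIdx.1 hα
  have h1 : ‖v‖ ^ (∑ i, α i) ≤ R ^ (∑ i, α i) := pow_le_pow_left₀ (norm_nonneg _) hv _
  have hM := hc α hα'
  have h2 : 1 ≤ R / r := (one_le_div hr).2 hrR
  calc ‖v‖ ^ (∑ i, α i) * ‖c α‖ ≤ R ^ (∑ i, α i) * ‖c α‖ := by gcongr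
    _ = (R / r) ^ (∑ i, α i) * (‖c α‖ * r ^ (∑ i, α i)) := by
      rw [div_pow]; field_simp
    _ ≤ (R / r) ^ d * M := by
      have : 0 ≤ ‖c α‖ * r ^ (∑ i, α i) := by positivity
      gcongr

theorem continuous_jetEval (d : ℕ) :
    Continuous fun p : ((Fin n → ℕ) → F) × EuclideanSpace ℝ (Fin n) => jetEval d p.1 p.2 := by
  unfold jetEval
  refine continuous_finsetSum _ fun α _ => ?_
  exact ((continuous_mono α).comp continuous_snd).smul ((continuous_apply α).comp continuous_fst)

/-- The coefficients of the polynomial with coefficients `c` after moving the center by `v`. -/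
def shiftJet (d : ℕ) (c : (Fin n → ℕ) → F) (v : EuclideanSpace ℝ (Fin n)) (α : Fin n → ℕ) : F :=
  jetEval (d - ∑ i, α i) (fun β => c (α + β)) v

/-- By the binomial formula `mono_add`, both sides are the same sum over pairs `(β, γ)` with `|β| +
|γ| ≤ d`, grouped by `β` on the left and by `β + γ` on the right. -/
theorem jetEval_shiftJet (d : ℕ) (c : (Fin n → ℕ) → F) (v w : EuclideanSpace ℝ (Fin n)) :
    jetEval d (shiftJet d c v) w = jetEval d c (v + w) := by
  unfold shiftJet jetEval
  simp only [mono_add, sum_smul, smul_sum, smul_smul]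
  rw [sum_sigma', sum_sigma']
  refine sum_bij' (fun x _ => ⟨x.1 + x.2, fun j => (x.2 j, x.1 j)⟩)
    (fun y _ => ⟨fun j => (y.2 j).2, fun j => (y.2 j).1⟩) ?_ ?_ ?_ ?_ ?_
  · rintro ⟨β, γ⟩ h
    simp only [mem_sigma, mem_multiIdx, Fintype.mem_piFinset, HasAntidiagonal.mem_antidiagonal, Pi.add_apply,
      sum_add_distrib] at h ⊢
    exact ⟨by omega, fun j => add_comm _ _⟩
  · rintro ⟨α, p⟩ h
    simp only [mem_sigma, mem_multiIdx, Fintype.mem_piFinset, HasAntidiagonal.mem_antidiagonal] at h ⊢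
    have : ∑ i, α i = ∑ i, (p i).1 + ∑ i, (p i).2 := by
      rw [← sum_add_distrib]
      exact sum_congr rfl fun j _ => (h.2 j).symm
    omega
  · rintro ⟨β, γ⟩ _
    rfl
  · rintro ⟨α, p⟩ h
    simp only [mem_sigma, mem_multiIdx, Fintype.mem_piFinset, HasAntidiagonal.mem_antidiagonal] at h
    have : ((fun j => (p j).2) + fun j => (p j).1) = α := by
      funext j
      rw [← h.2 j]
      exact add_comm _ _
    simp only [this, Prod.mk.eta]
  · rintro ⟨β, γ⟩ _
    simp only [mul_comm]

theorem shiftJet_of_sum_eq {d : ℕ} (c : (Fin n → ℕ) → F) (v : EuclideanSpace ℝ (Fin n))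
    {α : Fin n → ℕ} (hα : ∑ i, α i = d) : shiftJet d c v α = c α := by
  unfold shiftJet jetEval
  rw [hα, Nat.sub_self, sum_eq_single 0]
  · simp [mono_zero_left]
  · intro β hβ h0
    refine absurd ?_ h0
    have h1 := mem_multiIdx.1 hβ
    funext i
    exact (sum_eq_zero_iff.1 (Nat.le_zero.1 h1)) i (mem_univ i)
  · intro h
    exact absurd (mem_multiIdx.2 (by simp)) h

end Jet

/-- A real polynomial vanishing on the unit ball has vanishing coefficients. -/
theorem coeff_eq_zero_of_jetEval_real {n d : ℕ} {c : (Fin n → ℕ) → ℝ}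
    (h : ∀ v : EuclideanSpace ℝ (Fin n), ‖v‖ < 1 → jetEval d c v = 0)
    {α : Fin n → ℕ} (hα : ∑ i, α i ≤ d) : c α = 0 := by
  classical
  let P : MvPolynomial (Fin n) ℝ := ∑ β ∈ multiIdx n d,
    MvPolynomial.monomial (Finsupp.equivFunOnFinite.symm β)
      (c β / ∏ j, ((β j).factorial : ℝ))
  have hP : P = 0 := by
    -- A polynomial that vanishes on a product of infinite sets is zero. The side `1 / (n + 1)`
    -- gives `∑ x_j ^ 2 ≤ n / (n + 1) < 1`, so the box lies in the unit ball.
    refine MvPolynomial.funext_set (fun _ => Set.Ioo (0 : ℝ) (1 / (n + 1)))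
      (fun _ => Set.Ioo_infinite (by positivity)) fun x hx => ?_
    have hx' : ∀ j, 0 < x j ∧ x j < 1 / (n + 1) := fun j => hx j (Set.mem_univ j)
    have hn : ‖WithLp.toLp 2 x‖ < 1 := by
      rw [EuclideanSpace.norm_eq, Real.sqrt_lt' one_pos, one_pow]
      have h1 : ∀ j, ‖(WithLp.toLp 2 x) j‖ ^ 2 ≤ 1 / (n + 1) := fun j => by
        have h2 := hx' j
        have h3 : (1 : ℝ) / (n + 1) ≤ 1 := by
          rw [div_le_one (by positivity)]; linarith [(n.cast_nonneg : (0 : ℝ) ≤ n)]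
        rw [Real.norm_of_nonneg h2.1.le, sq]
        change x j * x j ≤ _
        nlinarith
      calc _ ≤ ∑ j : Fin n, (1 : ℝ) / (n + 1) := sum_le_sum fun j _ => h1 j
        _ = n / (n + 1) := by simp [div_eq_mul_inv]
        _ < 1 := by rw [div_lt_one (by positivity)]; linarith
    have := h _ hn
    rw [map_zero, map_sum, ← this]
    refine sum_congr rfl fun β _ => ?_
    rw [MvPolynomial.eval_monomial, Finsupp.prod_fintype _ _ (by simp)]
    simp only [mono, prod_div_distrib, smul_eq_mul, Finsupp.equivFunOnFinite_symm_apply_apply]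
    ring
  have h1 : P.coeff (Finsupp.equivFunOnFinite.symm α) = c α / ∏ j, ((α j).factorial : ℝ) := by
    rw [MvPolynomial.coeff_sum, sum_eq_single α]
    · simp
    · intro β _ hβ
      rw [MvPolynomial.coeff_monomial, if_neg]
      exact fun h => hβ (Finsupp.equivFunOnFinite.symm.injective h)
    · exact fun h => absurd (mem_multiIdx.2 hα) h
  rw [hP, MvPolynomial.coeff_zero, eq_comm, div_eq_zero_iff] at h1
  refine h1.resolve_right (prod_ne_zero_iff.2 fun j _ => ?_)
  exact_mod_cast Nat.factorial_ne_zero _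

/-- A polynomial vanishing on the unit ball has vanishing coefficients. -/
theorem coeff_eq_zero_of_jetEval {n m d : ℕ} {c : (Fin n → ℕ) → EuclideanSpace ℝ (Fin m)}
    (h : ∀ v : EuclideanSpace ℝ (Fin n), ‖v‖ < 1 → jetEval d c v = 0)
    {α : Fin n → ℕ} (hα : ∑ i, α i ≤ d) : c α = 0 := by
  ext i
  refine coeff_eq_zero_of_jetEval_real (c := fun β => c β i) (d := d) (fun v hv => ?_) hα
  have := congrArg (fun w : EuclideanSpace ℝ (Fin m) => w i) (h v hv)
  simpa [jetEval, WithLp.ofLp_sum] using this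

/-! ### Polynomials that are small on most of a ball -/

/-- The bound on all coefficients, including those of degree above `d`, makes Tychonoff's theorem
applicable in the infinite product. -/
theorem isCompact_unit_jets (n m d : ℕ) :
    IsCompact {c : (Fin n → ℕ) → EuclideanSpace ℝ (Fin m) |
      (∀ α, ‖c α‖ ≤ 1) ∧ ∃ α ∈ multiIdx n d, ‖c α‖ = 1} := by
  refine (isCompact_univ_pi fun _ : Fin n → ℕ =>
    isCompact_closedBall (0 : EuclideanSpace ℝ (Fin m)) 1).of_isClosed_subset ?_ ?_
  · refine IsClosed.inter (s₁ := {c : (Fin n → ℕ) → EuclideanSpace ℝ (Fin m) | ∀ α, ‖c α‖ ≤ 1})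
      (s₂ := {c | ∃ α ∈ multiIdx n d, ‖c α‖ = 1}) ?_ ?_
    · rw [Set.ofPred_forall]
      exact isClosed_iInter fun α => isClosed_le (continuous_apply α).norm continuous_const
    · have : {c : (Fin n → ℕ) → EuclideanSpace ℝ (Fin m) | ∃ α ∈ multiIdx n d, ‖c α‖ = 1}
          = ⋃ α ∈ multiIdx n d, {c | ‖c α‖ = 1} := by
        ext c; simp
      rw [this]
      exact Set.Finite.isClosed_biUnion (Finset.finite_toSet _) fun α _ =>
        isClosed_eq (continuous_apply α).norm continuous_const
  · intro c hc α _
    simpa using hc.1 α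

/-- A nonzero polynomial is nonzero at some `v` of the open unit ball, and by joint continuity it
stays above half that value for nearby coefficients at nearby points. Finitely many such
neighbourhoods cover the compact set of normalized jets. -/
theorem exists_volume_lower_bound (n m d : ℕ) :
    ∃ η : ℝ, 0 < η ∧ ∃ δ : ENNReal, 0 < δ ∧
      ∀ c : (Fin n → ℕ) → EuclideanSpace ℝ (Fin m),
        (∀ α, ‖c α‖ ≤ 1) → (∃ α ∈ multiIdx n d, ‖c α‖ = 1) →
        δ ≤ volume (Metric.ball (0 : EuclideanSpace ℝ (Fin n)) 1 ∩
          {v | η < ‖jetEval d c v‖}) := by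
  have key := (isCompact_unit_jets n m d).induction_on
    (p := fun S => ∃ η : ℝ, 0 < η ∧ ∃ δ : ENNReal, 0 < δ ∧ ∀ c ∈ S,
      δ ≤ volume (Metric.ball (0 : EuclideanSpace ℝ (Fin n)) 1 ∩ {v | η < ‖jetEval d c v‖}))
    ⟨1, one_pos, 1, one_pos, fun c hc => hc.elim⟩ ?_ ?_ ?_
  · obtain ⟨η, hη, δ, hδ, h⟩ := key
    exact ⟨η, hη, δ, hδ, fun c h1 h2 => h c ⟨h1, h2⟩⟩
  · rintro S T hST ⟨η, hη, δ, hδ, h⟩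
    exact ⟨η, hη, δ, hδ, fun c hc => h c (hST hc)⟩
  · rintro S T ⟨η, hη, δ, hδ, h⟩ ⟨η', hη', δ', hδ', h'⟩
    refine ⟨min η η', lt_min hη hη', min δ δ', lt_min hδ hδ', ?_⟩
    rintro c (hc | hc)
    · exact (min_le_left _ _).trans ((h c hc).trans (measure_mono
        (Set.inter_subset_inter_right _ fun v hv => by
          rw [Set.mem_ofPred_eq] at hv ⊢
          exact (min_le_left _ _).trans_lt hv)))
    · exact (min_le_right _ _).trans ((h' c hc).trans (measure_mono
        (Set.inter_subset_inter_right _ fun v hv => by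
          rw [Set.mem_ofPred_eq] at hv ⊢
          exact (min_le_right _ _).trans_lt hv)))
  · rintro c ⟨-, α, hα, hcα⟩
    have : ∃ v : EuclideanSpace ℝ (Fin n), ‖v‖ < 1 ∧ jetEval d c v ≠ 0 := by
      by_contra! H
      have := coeff_eq_zero_of_jetEval H (mem_multiIdx.1 hα)
      simp [this] at hcα
    obtain ⟨v, hv, hcv⟩ := this
    have hpos : 0 < ‖jetEval d c v‖ := norm_pos_iff.2 hcv
    have hopen : {p : ((Fin n → ℕ) → EuclideanSpace ℝ (Fin m)) × EuclideanSpace ℝ (Fin n) |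
        ‖jetEval d c v‖ / 2 < ‖jetEval d p.1 p.2‖} ∈ 𝓝 (c, v) :=
      (isOpen_lt continuous_const (continuous_jetEval d).norm).mem_nhds (half_lt_self hpos)
    obtain ⟨U, hU, V, hV, hUV⟩ := mem_nhds_prod_iff.1 hopen
    refine ⟨U, mem_nhdsWithin_of_mem_nhds hU, ‖jetEval d c v‖ / 2, half_pos hpos,
      volume (Metric.ball (0 : EuclideanSpace ℝ (Fin n)) 1 ∩ V), ?_, fun c' hc' => ?_⟩
    · exact Measure.measure_pos_of_mem_nhds _ (inter_mem (Metric.isOpen_ball.mem_nhds (by simpa)) hV)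
    · exact measure_mono (Set.inter_subset_inter_right _ fun w hw => by
        have := hUV (Set.mk_mem_prod hc' hw)
        rwa [Set.mem_ofPred_eq] at this ⊢)

open scoped Pointwise in
theorem volume_ball_inter_preimage {n : ℕ} (x : EuclideanSpace ℝ (Fin n)) {r : ℝ} (hr : 0 < r)
    (S : Set (EuclideanSpace ℝ (Fin n))) :
    volume (Metric.ball x r ∩ {y | y - x ∈ S}) =
      ENNReal.ofReal (r ^ n) *
        volume (Metric.ball (0 : EuclideanSpace ℝ (Fin n)) 1 ∩ {v | r • v ∈ S}) := by
  have h1 : Metric.ball x r ∩ {y | y - x ∈ S} = (fun y => y + (-x)) ⁻¹'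
      (r • (Metric.ball (0 : EuclideanSpace ℝ (Fin n)) 1 ∩ {v | r • v ∈ S})) := by
    ext y
    rw [Set.mem_preimage, Set.mem_smul_set_iff_inv_smul_mem₀ hr.ne', ← sub_eq_add_neg]
    simp only [Set.mem_inter_iff, Metric.mem_ball, Set.mem_ofPred_eq, sub_zero,
      smul_inv_smul₀ hr.ne', norm_smul, norm_inv, Real.norm_of_nonneg hr.le, dist_eq_norm]
    rw [inv_mul_lt_one₀ hr]
  rw [h1, measure_preimage_add_right, Measure.addHaar_smul]
  simp [abs_of_pos hr]

/-- If a polynomial is at most `M` on a large enough portion of a ball, its coefficients at the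
center of the ball are controlled by `M`. -/
theorem exists_coeff_bound (n m d : ℕ) :
    ∃ δ : ENNReal, 0 < δ ∧ ∃ K : ℝ, 0 < K ∧
      ∀ (c : (Fin n → ℕ) → EuclideanSpace ℝ (Fin m)) (x : EuclideanSpace ℝ (Fin n)) (r M : ℝ),
        0 < r → 0 ≤ M →
        volume (Metric.ball x r ∩ {y | M < ‖jetEval d c (y - x)‖})
          < δ * volume (Metric.ball x r) →
        ∀ α : Fin n → ℕ, ∑ i, α i ≤ d → ‖c α‖ * r ^ (∑ i, α i) ≤ K * M := by
  obtain ⟨η, hη, δ, hδ, h⟩ := exists_volume_lower_bound n m d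
  set V := volume (Metric.ball (0 : EuclideanSpace ℝ (Fin n)) 1) with hV
  have hV0 : V ≠ 0 := (Metric.measure_ball_pos _ _ one_pos).ne'
  have hVt : V ≠ ⊤ := measure_ball_lt_top.ne
  -- The hypothesis measures a proportion of the ball, hence the division by `V`. The coefficients
  -- are rescaled to the unit ball (`b`) and divided by the largest one, which produces a normalized
  -- jet.
  refine ⟨δ / V, ENNReal.div_pos hδ.ne' hVt, η⁻¹, inv_pos.2 hη, fun c x r M hr hM hlt => ?_⟩
  set b : (Fin n → ℕ) → EuclideanSpace ℝ (Fin m) := fun α => r ^ (∑ i, α i) • c α with hb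
  have hbn : ∀ α, ‖b α‖ = ‖c α‖ * r ^ (∑ i, α i) := fun α => by
    rw [hb, norm_smul, norm_pow, Real.norm_of_nonneg hr.le, mul_comm]
  obtain ⟨γ, hγ, hmax⟩ := exists_max_image (multiIdx n d) (fun α => ‖b α‖)
    ⟨0, mem_multiIdx.2 (by simp)⟩
  suffices hb' : ‖b γ‖ ≤ η⁻¹ * M by
    intro α hα
    rw [← hbn]
    exact (hmax α (mem_multiIdx.2 hα)).trans hb'
  by_contra! hcon
  have hbpos : 0 < ‖b γ‖ := lt_of_le_of_lt (by positivity) hcon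
  have h1 := h (fun α => if α ∈ multiIdx n d then ‖b γ‖⁻¹ • b α else 0) ?_ ⟨γ, hγ, ?_⟩
  · have hlt' : volume (Metric.ball (0 : EuclideanSpace ℝ (Fin n)) 1 ∩
        {v | r • v ∈ {w | M < ‖jetEval d c w‖}}) < δ := by
      have h2 := volume_ball_inter_preimage x hr {w | M < ‖jetEval d c w‖}
      have h3 := Measure.addHaar_ball_of_pos (volume : Measure (EuclideanSpace ℝ (Fin n))) x hr
      rw [finrank_euclideanSpace_fin] at h3
      have hlt2 : ENNReal.ofReal (r ^ n) * volume (Metric.ball (0 : EuclideanSpace ℝ (Fin n)) 1 ∩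
          {v | r • v ∈ {w | M < ‖jetEval d c w‖}}) < ENNReal.ofReal (r ^ n) * δ := by
        rw [← h2]
        refine hlt.trans_le (le_of_eq ?_)
        rw [h3, ← hV, mul_left_comm, ENNReal.div_mul_cancel hV0 hVt]
      exact lt_of_mul_lt_mul_left' hlt2
    refine absurd (h1.trans (measure_mono ?_)) (not_le.2 hlt')
    refine Set.inter_subset_inter_right _ fun v hv => ?_
    have h4 : jetEval d (fun α => if α ∈ multiIdx n d then ‖b γ‖⁻¹ • b α else 0) v
        = ‖b γ‖⁻¹ • jetEval d c (r • v) := by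
      rw [jetEval_smul_vec, ← jetEval_const_smul]
      refine jetEval_congr (fun α hα => ?_) v
      simp [mem_multiIdx.2 hα, hb]
    have h5 : η < ‖b γ‖⁻¹ * ‖jetEval d c (r • v)‖ := by
      have := hv
      rwa [Set.mem_ofPred_eq, h4, norm_smul, norm_inv, norm_norm] at this
    change M < ‖jetEval d c (r • v)‖
    rw [inv_mul_lt_iff₀ hη] at hcon
    rw [lt_inv_mul_iff₀ hbpos] at h5
    nlinarith
  · intro α
    by_cases hα : α ∈ multiIdx n d
    · simp only [hα, if_true, norm_smul, norm_inv, norm_norm]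
      rw [inv_mul_le_one₀ hbpos]
      exact hmax α hα
    · simp [hα]
  · simp only [hγ, if_true, norm_smul, norm_inv, norm_norm]
    exact inv_mul_cancel₀ hbpos.ne'

/-- The sup-norm version of `exists_coeff_bound`. -/
theorem exists_coeff_bound_of_forall (n m d : ℕ) :
    ∃ K : ℝ, 0 < K ∧
      ∀ (c : (Fin n → ℕ) → EuclideanSpace ℝ (Fin m)) (r M : ℝ), 0 < r →
        (∀ v : EuclideanSpace ℝ (Fin n), ‖v‖ < r → ‖jetEval d c v‖ ≤ M) →
        ∀ α : Fin n → ℕ, ∑ i, α i ≤ d → ‖c α‖ * r ^ (∑ i, α i) ≤ K * M := by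
  obtain ⟨δ, hδ, K, hK, h⟩ := exists_coeff_bound n m d
  refine ⟨K, hK, fun c r M hr hM => h c 0 r M hr ((norm_nonneg _).trans (hM 0 (by simpa))) ?_⟩
  have : Metric.ball (0 : EuclideanSpace ℝ (Fin n)) r ∩ {y | M < ‖jetEval d c (y - 0)‖} = ∅ := by
    refine Set.eq_empty_of_forall_notMem fun v hv => ?_
    have h1 : M < ‖jetEval d c (v - 0)‖ := hv.2
    rw [sub_zero] at h1
    exact absurd (hM v (by simpa using hv.1)) (not_le.2 h1)
  rw [this, measure_empty]
  exact ENNReal.mul_pos hδ.ne' (Metric.measure_ball_pos _ _ hr).ne'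

/-- Two polynomials which approximate the same function near `x` and near `z`, outside small sets,
have close coefficients. -/
theorem exists_two_point_bound {n : ℕ} (hn : 0 < n) (m d : ℕ) {s : ℝ} (hs : 0 ≤ s) :
    ∃ ε : ENNReal, 0 < ε ∧ ∃ K : ℝ, 0 < K ∧
      ∀ (f : EuclideanSpace ℝ (Fin n) → EuclideanSpace ℝ (Fin m))
        (x z : EuclideanSpace ℝ (Fin n)) (c c' : (Fin n → ℕ) → EuclideanSpace ℝ (Fin m))
        (r l : ℝ), 0 < r → ‖x - z‖ ≤ r → 0 ≤ l →
        volume (Metric.ball x r ∩ {y | l ≤ ‖f y - jetEval d c (y - x)‖ / ‖y - x‖ ^ s})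
          ≤ ε * volume (Metric.ball x r) →
        volume (Metric.ball z (2 * r) ∩ {y | l ≤ ‖f y - jetEval d c' (y - z)‖ / ‖y - z‖ ^ s})
          ≤ ε * volume (Metric.ball z (2 * r)) →
        ∀ α : Fin n → ℕ, ∑ i, α i ≤ d →
          ‖(c - shiftJet d c' (x - z)) α‖ * r ^ (∑ i, α i) ≤ K * (l * r ^ s) := by
  have : Nonempty (Fin n) := ⟨⟨0, hn⟩⟩
  obtain ⟨δ, hδ, K, hK, h⟩ := exists_coeff_bound n m d
  -- The ball of radius `2 * r` about `z` has `2 ^ n` times the volume of the ball about `x`, so the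
  -- two bad sets together fill less than the proportion `δ` of the latter.
  obtain ⟨ε, hε, hεδ⟩ : ∃ ε : ENNReal, 0 < ε ∧ ε * (1 + 2 ^ n) < δ := by
    have h2 : (1 + 2 ^ n : ENNReal) ≠ ⊤ := by simp
    obtain ⟨a, ha0, haδ⟩ := exists_between hδ
    refine ⟨a / (1 + 2 ^ n), ENNReal.div_pos ha0.ne' h2, ?_⟩
    rwa [ENNReal.div_mul_cancel (by positivity) h2]
  refine ⟨ε, hε, K * (1 + 2 ^ s), by positivity, fun f x z c c' r l hr hxz hl hx hz => ?_⟩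
  have hrs : 0 ≤ r ^ s := Real.rpow_nonneg hr.le s
  have h2s : (0 : ℝ) ≤ 2 ^ s := Real.rpow_nonneg (by norm_num) s
  have hM : 0 ≤ (1 + 2 ^ s) * (l * r ^ s) := by positivity
  have hmain := h (c - shiftJet d c' (x - z)) x r ((1 + 2 ^ s) * (l * r ^ s)) hr hM ?_
  · intro α hα
    rw [mul_assoc]
    exact hmain α hα
  set A := Metric.ball x r ∩ {y | l ≤ ‖f y - jetEval d c (y - x)‖ / ‖y - x‖ ^ s}
  set A' := Metric.ball z (2 * r) ∩ {y | l ≤ ‖f y - jetEval d c' (y - z)‖ / ‖y - z‖ ^ s}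
  -- At the points `x` and `z` the quotients may be divisions by zero and carry no information.
  -- These points are null because `n > 0`.
  have hsub : Metric.ball x r ∩ {y | (1 + 2 ^ s) * (l * r ^ s) <
      ‖jetEval d (c - shiftJet d c' (x - z)) (y - x)‖} ⊆ (A ∪ A') ∪ ({x} ∪ {z}) := by
    rintro y ⟨hy, hlt⟩
    by_contra hcon
    simp only [Set.mem_union, Set.mem_singleton_iff, not_or] at hcon
    obtain ⟨⟨hA, hA'⟩, hyx, hyz⟩ := hcon
    have hyx' : ‖y - x‖ < r := by simpa [dist_eq_norm] using hy
    have hyz' : ‖y - z‖ < 2 * r := by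
      calc ‖y - z‖ ≤ ‖y - x‖ + ‖x - z‖ := norm_sub_le_norm_sub_add_norm_sub _ _ _
        _ < 2 * r := by linarith
    have h1 : ‖f y - jetEval d c (y - x)‖ ≤ l * r ^ s := by
      have h0 : ‖f y - jetEval d c (y - x)‖ / ‖y - x‖ ^ s < l := by
        by_contra h'
        exact hA ⟨hy, not_lt.1 h'⟩
      have hp : 0 < ‖y - x‖ ^ s := Real.rpow_pos_of_pos (norm_pos_iff.2 (sub_ne_zero.2 hyx)) s
      rw [div_lt_iff₀ hp] at h0
      refine h0.le.trans (mul_le_mul_of_nonneg_left ?_ hl)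
      exact Real.rpow_le_rpow (norm_nonneg _) hyx'.le hs
    have h2 : ‖f y - jetEval d c' (y - z)‖ ≤ 2 ^ s * (l * r ^ s) := by
      have h0 : ‖f y - jetEval d c' (y - z)‖ / ‖y - z‖ ^ s < l := by
        by_contra h'
        exact hA' ⟨by simpa [dist_eq_norm] using hyz', not_lt.1 h'⟩
      have hp : 0 < ‖y - z‖ ^ s := Real.rpow_pos_of_pos (norm_pos_iff.2 (sub_ne_zero.2 hyz)) s
      rw [div_lt_iff₀ hp] at h0
      refine h0.le.trans ?_
      have := Real.rpow_le_rpow (norm_nonneg _) hyz'.le hs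
      rw [Real.mul_rpow (by norm_num) hr.le] at this
      calc l * ‖y - z‖ ^ s ≤ l * (2 ^ s * r ^ s) := by gcongr
        _ = 2 ^ s * (l * r ^ s) := by ring
    have h3 : jetEval d (c - shiftJet d c' (x - z)) (y - x)
        = (f y - jetEval d c' (y - z)) - (f y - jetEval d c (y - x)) := by
      rw [jetEval_sub, jetEval_shiftJet, show x - z + (y - x) = y - z by abel]
      abel
    have h4 : (1 + 2 ^ s) * (l * r ^ s) < ‖jetEval d (c - shiftJet d c' (x - z)) (y - x)‖ := hlt
    rw [h3] at h4
    have := norm_sub_le (f y - jetEval d c' (y - z)) (f y - jetEval d c (y - x))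
    linarith
  have hvol : volume (Metric.ball z (2 * r)) = 2 ^ n * volume (Metric.ball x r) := by
    rw [Measure.addHaar_ball_of_pos _ _ (by positivity : 0 < 2 * r), Measure.addHaar_ball_of_pos _ x hr,
      finrank_euclideanSpace_fin, mul_pow, ENNReal.ofReal_mul (by positivity), mul_assoc]
    simp
  have hb0 : volume (Metric.ball x r) ≠ 0 := (Metric.measure_ball_pos _ _ hr).ne'
  have hbt : volume (Metric.ball x r) ≠ ⊤ := measure_ball_lt_top.ne
  calc volume _ ≤ volume ((A ∪ A') ∪ ({x} ∪ {z})) := measure_mono hsub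
    _ ≤ (volume A + volume A') + (volume {x} + volume {z}) :=
      (measure_union_le _ _).trans (add_le_add (measure_union_le _ _) (measure_union_le _ _))
    _ ≤ (ε * volume (Metric.ball x r) + ε * (2 ^ n * volume (Metric.ball x r))) + (0 + 0) := by
      rw [← hvol]
      gcongr <;> simp
    _ = (ε * (1 + 2 ^ n)) * volume (Metric.ball x r) := by ring
    _ < δ * volume (Metric.ball x r) := ENNReal.mul_lt_mul_left hb0 hbt hεδ

/-! ### Approximate Taylor polynomials -/

theorem HasDensityZeroAt.eventually_le {n : ℕ} {S : Set (EuclideanSpace ℝ (Fin n))}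
    {x : EuclideanSpace ℝ (Fin n)} (h : HasDensityZeroAt S x) {ε : ENNReal} (hε : 0 < ε) :
    ∃ r₀ : ℝ, 0 < r₀ ∧ ∀ r, 0 < r → r < r₀ →
      volume (Metric.ball x r ∩ S) ≤ ε * volume (Metric.ball x r) := by
  have h1 := h.eventually (gt_mem_nhds hε)
  rw [eventually_nhdsWithin_iff, Metric.eventually_nhds_iff] at h1
  obtain ⟨r₀, hr₀, h2⟩ := h1
  refine ⟨r₀, hr₀, fun r hr hrr => ?_⟩
  have h3 := h2 (by simpa [abs_of_pos hr] using hrr) hr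
  exact (ENNReal.div_le_iff (Metric.measure_ball_pos _ _ hr).ne' measure_ball_lt_top.ne).1 h3.le

theorem HasDensityZeroAt.mono {n : ℕ} {S T : Set (EuclideanSpace ℝ (Fin n))}
    {x : EuclideanSpace ℝ (Fin n)} (h : HasDensityZeroAt T x) (hST : S ⊆ T) :
    HasDensityZeroAt S x :=
  tendsto_of_tendsto_of_tendsto_of_le_of_le tendsto_const_nhds h (fun _ => zero_le)
    fun _ => ENNReal.div_le_div_right (measure_mono (Set.inter_subset_inter_right _ hST)) _

theorem isApproxTaylorPoly_iff {n m : ℕ}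
    {f : EuclideanSpace ℝ (Fin n) → EuclideanSpace ℝ (Fin m)} {d : ℕ} {s : ℝ}
    {x : EuclideanSpace ℝ (Fin n)} {c : (Fin n → ℕ) → EuclideanSpace ℝ (Fin m)} :
    IsApproxTaylorPoly f d s x c ↔ ∃ l : ℝ,
      HasDensityZeroAt {y | l ≤ ‖f y - jetEval d c (y - x)‖ / ‖y - x‖ ^ s} x := by
  unfold IsApproxTaylorPoly apLimsup
  simp only [centeredPoly_eq_jetEval]
  rw [sInf_lt_iff]
  constructor
  · rintro ⟨_, ⟨l, -, hl⟩, -⟩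
    exact ⟨l, hl⟩
  · rintro ⟨l, hl⟩
    exact ⟨l, ⟨l, rfl, hl⟩, EReal.coe_lt_top l⟩

/-- Approximate Taylor polynomials of order `s > d` are unique. -/
theorem IsApproxTaylorPoly.coeff_eq {n m : ℕ} (hn : 0 < n)
    {f : EuclideanSpace ℝ (Fin n) → EuclideanSpace ℝ (Fin m)} {d : ℕ} {s : ℝ} (hs : (d : ℝ) < s)
    {x : EuclideanSpace ℝ (Fin n)} {c c' : (Fin n → ℕ) → EuclideanSpace ℝ (Fin m)}
    (hc : IsApproxTaylorPoly f d s x c) (hc' : IsApproxTaylorPoly f d s x c')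
    {α : Fin n → ℕ} (hα : ∑ i, α i ≤ d) : c α = c' α := by
  obtain ⟨l, hl⟩ := isApproxTaylorPoly_iff.1 hc
  obtain ⟨l', hl'⟩ := isApproxTaylorPoly_iff.1 hc'
  obtain ⟨ε, hε, K, hK, h⟩ := exists_two_point_bound hn m d (d.cast_nonneg.trans hs.le)
  set L := max (max l l') 0 with hL
  obtain ⟨r₀, hr₀, h0⟩ := (hl.mono (S := {y | L ≤ ‖f y - jetEval d c (y - x)‖ / ‖y - x‖ ^ s})
    fun y hy => by
      rw [Set.mem_ofPred_eq] at hy ⊢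
      exact ((le_max_left _ _).trans (le_max_left _ _)).trans hy).eventually_le hε
  obtain ⟨r₁, hr₁, h1⟩ := (hl'.mono (S := {y | L ≤ ‖f y - jetEval d c' (y - x)‖ / ‖y - x‖ ^ s})
    fun y hy => by
      rw [Set.mem_ofPred_eq] at hy ⊢
      exact ((le_max_right _ _).trans (le_max_left _ _)).trans hy).eventually_le hε
  -- The two-point bound with `z = x` involves no shift. The exponent `s - |α|` is positive, so `r →
  -- 0` forces equality. The second density estimate is used at radius `2 * r`, hence `r₁ / 2`.
  have hbound : ∀ r, 0 < r → r < min r₀ (r₁ / 2) →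
      ‖c α - c' α‖ ≤ K * L * r ^ (s - (∑ i, α i : ℕ)) := by
    intro r hr hrm
    have hr0 := hrm.trans_le (min_le_left _ _)
    have hr1 := hrm.trans_le (min_le_right _ _)
    have h2 := h f x x c c' r L hr (by simpa using hr.le) (le_max_right _ _) (h0 r hr hr0)
      (h1 (2 * r) (by positivity) (by linarith)) α hα
    have h3 : shiftJet d c' (x - x) α = c' α := by
      rw [sub_self, shiftJet, jetEval_zero_vec, add_zero]
    rw [Pi.sub_apply, h3, ← le_div_iff₀ (by positivity)] at h2
    rwa [Real.rpow_sub hr, Real.rpow_natCast, mul_assoc, ← mul_div_assoc, ← mul_div_assoc]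
  have hpos : 0 < s - (∑ i, α i : ℕ) := by
    have : ((∑ i, α i : ℕ) : ℝ) ≤ d := by exact_mod_cast hα
    linarith
  have hlim : Tendsto (fun r : ℝ => K * L * r ^ (s - (∑ i, α i : ℕ))) (𝓝[>] 0) (𝓝 0) := by
    have h4 := (Real.continuousAt_rpow_const 0 (s - (∑ i, α i : ℕ)) (Or.inr hpos.le)).tendsto
    rw [Real.zero_rpow hpos.ne'] at h4
    simpa using (h4.const_mul (K * L)).mono_left nhdsWithin_le_nhds
  have h5 : ‖c α - c' α‖ ≤ 0 := by
    refine ge_of_tendsto hlim ?_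
    have : Set.Ioo (0 : ℝ) (min r₀ (r₁ / 2)) ∈ 𝓝[>] (0 : ℝ) :=
      Ioo_mem_nhdsGT (lt_min hr₀ (half_pos hr₁))
    filter_upwards [this] with r hr
    exact hbound r hr.1 hr.2
  exact sub_eq_zero.1 (norm_le_zero_iff.1 h5)

/-! ### The converse of Taylor's theorem -/

theorem hasFDerivAt_zero_of_norm_le_rpow {E F : Type*} [NormedAddCommGroup E] [NormedSpace ℝ E]
    [NormedAddCommGroup F] [NormedSpace ℝ F] {g : E → F} {x : E} {K p : ℝ} (hp : 1 < p)
    (hg : ∀ y, ‖g y‖ ≤ K * ‖y - x‖ ^ p) : HasFDerivAt g (0 : E →L[ℝ] F) x := by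
  have hgx : g x = 0 := by
    have := hg x
    rw [sub_self, norm_zero, Real.zero_rpow (by linarith), mul_zero] at this
    exact norm_le_zero_iff.1 this
  rw [hasFDerivAt_iff_isLittleO, Asymptotics.isLittleO_iff]
  intro ε hε
  have h1 : Tendsto (fun y => K * ‖y - x‖ ^ (p - 1)) (𝓝 x) (𝓝 0) := by
    have h2 : Continuous fun y => K * ‖y - x‖ ^ (p - 1) :=
      continuous_const.mul ((by fun_prop : Continuous fun y => ‖y - x‖).rpow_const
        fun _ => Or.inr (by linarith))
    have h3 := h2.tendsto x
    rwa [sub_self, norm_zero, Real.zero_rpow (by linarith), mul_zero] at h3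
  filter_upwards [h1.eventually (gt_mem_nhds hε)] with y hy
  rw [hgx]
  simp only [sub_zero, zero_apply]
  refine (hg y).trans ?_
  rcases eq_or_ne y x with rfl | hne
  · simp [Real.zero_rpow (by linarith : p ≠ 0)]
  · have hpos : 0 < ‖y - x‖ := norm_pos_iff.2 (sub_ne_zero.2 hne)
    have h4 : ‖y - x‖ ^ p = ‖y - x‖ ^ (p - 1) * ‖y - x‖ := by
      rw [Real.rpow_sub_one hpos.ne', div_mul_cancel₀ _ hpos.ne']
    rw [h4, ← mul_assoc]
    gcongr

theorem sum_single_one {n : ℕ} (i : Fin n) (k : ℕ) : ∑ j, (Pi.single i k : Fin n → ℕ) j = k := by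
  simp

theorem exists_eq_single_of_sum_eq_one {n : ℕ} {β : Fin n → ℕ} (h : ∑ i, β i = 1) :
    ∃ i, β = Pi.single i 1 := by
  obtain ⟨i, hi⟩ : ∃ i, β i ≠ 0 := by
    by_contra! H
    simp [H] at h
  have h1 := add_sum_erase univ β (mem_univ i)
  refine ⟨i, funext fun j => ?_⟩
  by_cases hj : j = i
  · subst hj
    have : β j ≤ 1 := h ▸ single_le_sum (fun _ _ => Nat.zero_le _) (mem_univ j)
    rw [Pi.single_eq_same]
    omega
  · rw [Pi.single_eq_of_ne hj]
    have h2 : ∑ k ∈ univ.erase i, β k = 0 := by omega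
    exact sum_eq_zero_iff.1 h2 j (mem_erase.2 ⟨hj, mem_univ j⟩)

theorem hasFDerivAt_mono_zero {n : ℕ} (β : Fin n → ℕ) :
    HasFDerivAt (mono β) (∑ j, if β = Pi.single j 1 then
      (EuclideanSpace.proj j : EuclideanSpace ℝ (Fin n) →L[ℝ] ℝ) else 0) 0 := by
  rcases Nat.lt_trichotomy (∑ i, β i) 1 with h | h | h
  · have hβ : β = 0 := by
      funext i
      exact sum_eq_zero_iff.1 (Nat.lt_one_iff.1 h) i (mem_univ i)
    subst hβ
    have h1 : (mono (0 : Fin n → ℕ)) = fun _ => (1 : ℝ) := funext mono_zero_left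
    have h2 : ∀ j : Fin n, (0 : Fin n → ℕ) ≠ Pi.single j 1 := fun j h => by
      have := congrFun h j
      simp at this
    rw [h1]
    simp only [h2, if_false, sum_const_zero]
    exact hasFDerivAt_const _ _
  · obtain ⟨i, rfl⟩ := exists_eq_single_of_sum_eq_one h
    have h1 : mono (Pi.single i 1) = fun v : EuclideanSpace ℝ (Fin n) => v i :=
      funext (mono_single i)
    rw [h1, sum_eq_single i]
    · simp only [if_true]
      exact (EuclideanSpace.proj i : EuclideanSpace ℝ (Fin n) →L[ℝ] ℝ).hasFDerivAt
    · intro j _ hj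
      rw [if_neg]
      intro h2
      have := congrFun h2 i
      rw [Pi.single_eq_same, Pi.single_eq_of_ne hj.symm] at this
      omega
    · simp
  · have h2 : ∀ j : Fin n, β ≠ Pi.single j 1 := fun j h3 => by
      rw [h3, sum_single_one] at h
      omega
    simp only [h2, if_false, sum_const_zero]
    refine Asymptotics.IsBigO.hasFDerivAt (n := ∑ i, β i) ?_ h
    refine Asymptotics.IsBigO.of_bound 1 (Eventually.of_forall fun v => ?_)
    rw [sub_zero, one_mul, norm_pow, norm_norm]
    exact abs_mono_le β v

/-- The linear map with partial derivatives `w j`. -/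
def gradMap {n : ℕ} {F : Type*} [NormedAddCommGroup F] [NormedSpace ℝ F] (w : Fin n → F) :
    EuclideanSpace ℝ (Fin n) →L[ℝ] F :=
  ∑ j, (EuclideanSpace.proj j : EuclideanSpace ℝ (Fin n) →L[ℝ] ℝ).smulRight (w j)

theorem gradMap_single {n : ℕ} {F : Type*} [NormedAddCommGroup F] [NormedSpace ℝ F]
    (w : Fin n → F) (i : Fin n) : gradMap w (EuclideanSpace.single i 1) = w i := by
  simp [gradMap]

theorem hasFDerivAt_jetEval_zero {n : ℕ} {F : Type*} [NormedAddCommGroup F] [NormedSpace ℝ F]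
    {e : ℕ} (he : 0 < e) (b : (Fin n → ℕ) → F) :
    HasFDerivAt (jetEval e b) (gradMap fun j => b (Pi.single j 1)) 0 := by
  have h1 := HasFDerivAt.fun_sum (u := multiIdx n e)
    fun β _ => (hasFDerivAt_mono_zero β).smul_const (b β)
  refine h1.congr_fderiv ?_
  ext v
  simp only [gradMap, _root_.sum_apply, ContinuousLinearMap.smulRight_apply, sum_smul]
  rw [sum_comm]
  refine sum_congr rfl fun j _ => ?_
  rw [sum_eq_single (Pi.single j 1)]
  · simp
  · intro β _ hβ
    simp [hβ]
  · intro h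
    exact absurd (mem_multiIdx.2 (by rw [sum_single_one]; omega)) h

section ConverseTaylor

variable {n m d : ℕ} {u : EuclideanSpace ℝ (Fin n) → EuclideanSpace ℝ (Fin m)} {C t : ℝ}
  {c : EuclideanSpace ℝ (Fin n) → (Fin n → ℕ) → EuclideanSpace ℝ (Fin m)}

/-- On the ball of radius `|y - x|` about `y`, the polynomials attached to `x` and to `y` both
approximate `u` to order `|y - x| ^ (d + t)`. The coefficient bound on this ball costs a factor `|y
- x| ^ (-|α|)`. -/
theorem exists_norm_coeff_sub_shiftJet_le (ht : 0 < t) (hC : 0 ≤ C)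
    (h : ∀ x y, ‖u y - jetEval d (c x) (y - x)‖ ≤ C * ‖y - x‖ ^ ((d : ℝ) + t)) :
    ∃ K : ℝ, 0 ≤ K ∧ ∀ x y (α : Fin n → ℕ), ∑ i, α i ≤ d →
      ‖c y α - shiftJet d (c x) (y - x) α‖ ≤ K * ‖y - x‖ ^ ((d : ℝ) + t - (∑ i, α i : ℕ)) := by
  obtain ⟨K, hK, hcoef⟩ := exists_coeff_bound_of_forall n m d
  have hs : 0 ≤ (d : ℝ) + t := by positivity
  have h2s : (0 : ℝ) ≤ 2 ^ ((d : ℝ) + t) := Real.rpow_nonneg (by norm_num) _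
  refine ⟨K * (C * (1 + 2 ^ ((d : ℝ) + t))), by positivity, fun x y α hα => ?_⟩
  rcases eq_or_ne y x with rfl | hne
  · rw [sub_self, shiftJet, jetEval_zero_vec, add_zero, sub_self, norm_zero]
    positivity
  have hr : 0 < ‖y - x‖ := norm_pos_iff.2 (sub_ne_zero.2 hne)
  have h1 := hcoef (c y - shiftJet d (c x) (y - x)) ‖y - x‖
    (C * (1 + 2 ^ ((d : ℝ) + t)) * ‖y - x‖ ^ ((d : ℝ) + t)) hr ?_ α hα
  · rw [Real.rpow_sub hr, Real.rpow_natCast, ← mul_div_assoc, le_div_iff₀ (by positivity), mul_assoc]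
    exact h1
  · intro v hv
    have h2 : jetEval d (c y - shiftJet d (c x) (y - x)) v =
        (u (y + v) - jetEval d (c x) (y + v - x)) - (u (y + v) - jetEval d (c y) (y + v - y)) := by
      rw [jetEval_sub, jetEval_shiftJet, show y + v - x = y - x + v by abel,
        show y + v - y = v by abel]
      abel
    rw [h2]
    refine (norm_sub_le _ _).trans ?_
    have h3 := h x (y + v)
    have h4 := h y (y + v)
    have h5 : ‖y + v - x‖ ^ ((d : ℝ) + t) ≤ 2 ^ ((d : ℝ) + t) * ‖y - x‖ ^ ((d : ℝ) + t) := by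
      rw [← Real.mul_rpow (by norm_num) hr.le]
      refine Real.rpow_le_rpow (norm_nonneg _) ?_ hs
      rw [show y + v - x = y - x + v by abel]
      linarith [norm_add_le (y - x) v]
    have h6 : ‖y + v - y‖ ^ ((d : ℝ) + t) ≤ ‖y - x‖ ^ ((d : ℝ) + t) := by
      rw [add_sub_cancel_left]
      exact Real.rpow_le_rpow (norm_nonneg _) hv.le hs
    have h7 := mul_le_mul_of_nonneg_left h5 hC
    have h8 := mul_le_mul_of_nonneg_left h6 hC
    linarith

/-- For `|α| < d` the exponent `d + t - |α|` exceeds one, so the coefficient differs from the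
recentred polynomial of `x` by a term with zero derivative at `x`. The derivative of that polynomial
at its center is its linear part. -/
theorem hasFDerivAt_coeff (ht : 0 < t) (hC : 0 ≤ C)
    (h : ∀ x y, ‖u y - jetEval d (c x) (y - x)‖ ≤ C * ‖y - x‖ ^ ((d : ℝ) + t))
    {α : Fin n → ℕ} (hα : ∑ i, α i < d) (x : EuclideanSpace ℝ (Fin n)) :
    HasFDerivAt (fun y => c y α) (gradMap fun j => c x (α + Pi.single j 1)) x := by
  obtain ⟨K, hK, h1⟩ := exists_norm_coeff_sub_shiftJet_le ht hC h
  have h2 : HasFDerivAt (fun y => c y α - shiftJet d (c x) (y - x) α)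
      (0 : EuclideanSpace ℝ (Fin n) →L[ℝ] EuclideanSpace ℝ (Fin m)) x := by
    refine hasFDerivAt_zero_of_norm_le_rpow ?_ fun y => h1 x y α hα.le
    have : ((∑ i, α i : ℕ) : ℝ) + 1 ≤ d := by exact_mod_cast hα
    linarith
  have h3 : HasFDerivAt (fun y => shiftJet d (c x) (y - x) α)
      (gradMap fun j => c x (α + Pi.single j 1)) x := by
    have h4 := hasFDerivAt_jetEval_zero (Nat.sub_pos_of_lt hα) (fun β => c x (α + β))
    have h5 : HasFDerivAt (fun y => y - x) (ContinuousLinearMap.id ℝ (EuclideanSpace ℝ (Fin n))) x :=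
      (hasFDerivAt_id x).sub_const x
    have h6 : HasFDerivAt (jetEval (d - ∑ i, α i) fun β => c x (α + β))
        (gradMap fun j => c x (α + Pi.single j 1)) (x - x) := by
      rw [sub_self]
      exact h4
    simpa [Function.comp_def, shiftJet] using HasFDerivAt.comp (f := fun y => y - x) x h6 h5
  simpa using h2.fun_add h3

theorem contDiff_coeff (ht : 0 < t) (hC : 0 ≤ C)
    (h : ∀ x y, ‖u y - jetEval d (c x) (y - x)‖ ≤ C * ‖y - x‖ ^ ((d : ℝ) + t)) (j : ℕ) :
    ∀ α : Fin n → ℕ, ∑ i, α i + j ≤ d → ContDiff ℝ j (fun y => c y α) := by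
  induction j with
  | zero =>
    intro α hα
    rw [Nat.cast_zero, contDiff_zero]
    rcases (Nat.le_of_add_right_le hα).lt_or_eq with hlt | heq
    · exact continuous_iff_continuousAt.2 fun x => (hasFDerivAt_coeff ht hC h hlt x).continuousAt
    -- In top degree there is no derivative to invoke. The recentred coefficient is constant there,
    -- and the bound with exponent `t` gives continuity.
    · obtain ⟨K, hK, h1⟩ := exists_norm_coeff_sub_shiftJet_le ht hC h
      refine continuous_iff_continuousAt.2 fun x => ?_
      have h2 : Continuous fun y => K * ‖y - x‖ ^ t :=
        continuous_const.mul ((by fun_prop : Continuous fun y => ‖y - x‖).rpow_const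
          fun _ => Or.inr ht.le)
      have h3 := h2.tendsto x
      rw [sub_self, norm_zero, Real.zero_rpow ht.ne', mul_zero] at h3
      rw [ContinuousAt, tendsto_iff_norm_sub_tendsto_zero]
      refine squeeze_zero (fun _ => norm_nonneg _) (fun y => ?_) h3
      have h4 := h1 x y α heq.le
      rwa [shiftJet_of_sum_eq _ _ heq, heq, add_sub_cancel_left] at h4
  | succ j ih =>
    intro α hα
    rw [Nat.cast_succ, contDiff_succ_iff_hasFDerivAt]
    refine ⟨fun x => gradMap fun i => c x (α + Pi.single i 1), ?_,
      fun x => hasFDerivAt_coeff ht hC h (by omega) x⟩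
    unfold gradMap
    refine ContDiff.sum fun i _ => contDiff_const.smulRight (ih _ ?_)
    simp only [Pi.add_apply, sum_add_distrib, sum_single_one]
    omega

theorem partialDeriv_iterate_coeff (ht : 0 < t) (hC : 0 ≤ C)
    (h : ∀ x y, ‖u y - jetEval d (c x) (y - x)‖ ≤ C * ‖y - x‖ ^ ((d : ℝ) + t))
    (i : Fin n) (k : ℕ) {α : Fin n → ℕ} (hα : ∑ i, α i + k ≤ d) :
    (partialDeriv i)^[k] (fun y => c y α) = fun y => c y (α + Pi.single i k) := by
  induction k with
  | zero => simp
  | succ k ih =>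
    rw [Function.iterate_succ_apply', ih (by omega)]
    funext x
    have h1 := hasFDerivAt_coeff ht hC h (α := α + Pi.single i k) (by
      simp only [Pi.add_apply, sum_add_distrib, sum_single_one]
      omega) x
    have h2 := (h1.hasLineDerivAt (EuclideanSpace.single i 1)).lineDeriv
    rw [gradMap_single, add_assoc, ← Pi.single_add] at h2
    exact h2

theorem multiDeriv_eq_coeff (ht : 0 < t) (hC : 0 ≤ C)
    (h : ∀ x y, ‖u y - jetEval d (c x) (y - x)‖ ≤ C * ‖y - x‖ ^ ((d : ℝ) + t))
    {α : Fin n → ℕ} (hα : ∑ i, α i ≤ d) : multiDeriv α u = fun y => c y α := by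
  have hu : u = fun y => c y 0 := by
    funext x
    have h1 := h x x
    rw [sub_self, jetEval_zero_vec, norm_zero, Real.zero_rpow (by positivity), mul_zero] at h1
    exact sub_eq_zero.1 (norm_le_zero_iff.1 h1)
  -- Once the variables in `l` have been processed, the multi-index agrees with `α` on `l` and
  -- vanishes elsewhere. Distinctness of the entries of `l` prevents a variable from being counted
  -- twice.
  have key : ∀ l : List (Fin n), l.Nodup →
      l.foldr (fun i g => (partialDeriv i)^[α i] g) u
        = fun y => c y (fun i => if i ∈ l then α i else 0) := by
    intro l
    induction l with
    | nil =>
      intro _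
      simp only [List.foldr_nil, List.not_mem_nil, if_false]
      exact hu
    | cons i l ih =>
      intro hl
      rw [List.nodup_cons] at hl
      rw [List.foldr_cons, ih hl.2]
      have h1 : (fun j => if j ∈ l then α j else 0) + Pi.single i (α i)
          = fun j => if j ∈ i :: l then α j else 0 := by
        funext j
        by_cases hj : j = i
        · subst hj
          simp [hl.1]
        · simp [hj]
      have h2 : ∑ j, (if j ∈ i :: l then α j else 0) ≤ ∑ j, α j :=
        sum_le_sum fun j _ => by split_ifs <;> omega
      rw [partialDeriv_iterate_coeff ht hC h, h1]
      have h3 : ∑ j, ((fun j => if j ∈ l then α j else 0) + Pi.single i (α i) : Fin n → ℕ) j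
          = ∑ j, (if j ∈ i :: l then α j else 0) := by rw [h1]
      simp only [Pi.add_apply, sum_add_distrib, sum_single_one] at h3
      omega
  unfold multiDeriv
  rw [key _ (List.nodup_finRange n)]
  simp

/-- A bounded function which is uniformly approximated to order `d + t` by polynomials of degree
at most `d` at every point is of class `C^{d,t}`. -/
theorem isCHolder_of_forall_approx (ht : 0 < t) (ht1 : t ≤ 1) (hC : 0 ≤ C)
    (h : ∀ x y, ‖u y - jetEval d (c x) (y - x)‖ ≤ C * ‖y - x‖ ^ ((d : ℝ) + t))
    {M : ℝ} (hu : ∀ x, ‖u x‖ ≤ M) : IsCHolder d t u := by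
  refine ⟨?_, fun α hα => ?_⟩
  · have h1 := multiDeriv_eq_coeff ht hC h (α := 0) (by simp)
    have h2 : multiDeriv 0 u = u := by
      unfold multiDeriv
      simp
    rw [← h2, h1]
    exact contDiff_coeff ht hC h d 0 (by simp)
  obtain ⟨K, hK, h1⟩ := exists_norm_coeff_sub_shiftJet_le ht hC h
  obtain ⟨A, hA, hcoef⟩ := exists_coeff_bound_of_forall n m d
  have hs : 0 ≤ (d : ℝ) + t := by positivity
  have hbd : ∀ x (β : Fin n → ℕ), ∑ i, β i ≤ d → ‖c x β‖ ≤ A * (M + C) := by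
    intro x β hβ
    have h2 := hcoef (c x) 1 (M + C) one_pos (fun v hv => ?_) β hβ
    · simpa using h2
    · have h3 := h x (x + v)
      rw [add_sub_cancel_left] at h3
      have h4 : ‖v‖ ^ ((d : ℝ) + t) ≤ 1 := Real.rpow_le_one (norm_nonneg _) hv.le hs
      have h5 := norm_sub_norm_le (jetEval d (c x) v) (u (x + v))
      rw [norm_sub_rev] at h5
      have h6 := hu (x + v)
      have h7 := mul_le_mul_of_nonneg_left h4 hC
      linarith
  set B := A * (M + C) with hB
  have hB0 : 0 ≤ B := (norm_nonneg _).trans (hbd 0 0 (by simp))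
  set D : ℝ := ((multiIdx n (d - ∑ i, α i)).card : ℝ) with hD
  have hD0 : 0 ≤ D := Nat.cast_nonneg _
  refine ⟨2 * B + K + D * B, fun y x => ?_⟩
  rw [multiDeriv_eq_coeff ht hC h hα]
  change ‖c y α - c x α‖ ≤ _
  have hr0 : 0 ≤ ‖y - x‖ ^ t := Real.rpow_nonneg (norm_nonneg _) t
  -- At distance at least one, boundedness of the coefficients suffices. At distance at most one,
  -- the comparison goes through the recentred polynomial, whose nonconstant terms are `O(|y - x|)`,
  -- and `|y - x| ≤ |y - x| ^ t` as `t ≤ 1`.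
  rcases le_total 1 ‖y - x‖ with hr | hr
  · have h2 : 1 ≤ ‖y - x‖ ^ t := Real.one_le_rpow hr ht.le
    have h3 := norm_sub_le (c y α) (c x α)
    have h4 := hbd y α hα
    have h5 := hbd x α hα
    calc ‖c y α - c x α‖ ≤ (2 * B) * 1 := by linarith
      _ ≤ (2 * B + K + D * B) * ‖y - x‖ ^ t := by
        gcongr
        have := mul_nonneg hD0 hB0
        linarith
  · have h2 : ‖c y α - shiftJet d (c x) (y - x) α‖ ≤ K * ‖y - x‖ ^ t := by
      refine (h1 x y α hα).trans (mul_le_mul_of_nonneg_left ?_ hK)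
      rcases eq_or_ne y x with rfl | hne
      · rw [sub_self, norm_zero, Real.zero_rpow ht.ne', Real.zero_rpow]
        have : ((∑ i, α i : ℕ) : ℝ) ≤ d := by exact_mod_cast hα
        linarith
      · refine Real.rpow_le_rpow_of_exponent_ge (norm_pos_iff.2 (sub_ne_zero.2 hne)) hr ?_
        have : ((∑ i, α i : ℕ) : ℝ) ≤ d := by exact_mod_cast hα
        linarith
    have h3 : ‖shiftJet d (c x) (y - x) α - c x α‖ ≤ D * B * ‖y - x‖ ^ t := by
      have h4 : shiftJet d (c x) (y - x) α - c x α
          = jetEval (d - ∑ i, α i) (fun β => if β = 0 then 0 else c x (α + β)) (y - x) := by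
        unfold shiftJet jetEval
        rw [← add_sum_erase _ _ (mem_multiIdx.2 (by simp) : (0 : Fin n → ℕ) ∈ _),
          ← add_sum_erase _ _ (mem_multiIdx.2 (by simp) : (0 : Fin n → ℕ) ∈ _)]
        beta_reduce
        rw [mono_zero_left, one_smul, one_smul, add_zero, if_pos rfl, zero_add,
          add_sub_cancel_left]
        refine sum_congr rfl fun β hβ => ?_
        rw [if_neg (mem_erase.1 hβ).1]
      rw [h4]
      refine (norm_jetEval_le _ _ _).trans ?_
      rw [mul_assoc, hD, ← nsmul_eq_mul]
      refine sum_le_card_nsmul _ _ _ fun β hβ => ?_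
      by_cases hβ0 : β = 0
      · rw [if_pos hβ0, norm_zero, mul_zero]
        positivity
      · rw [if_neg hβ0, mul_comm]
        have hβ1 : 1 ≤ ∑ i, β i := by
          by_contra hlt
          refine hβ0 (funext fun i => ?_)
          exact sum_eq_zero_iff.1 (Nat.lt_one_iff.1 (not_le.1 hlt)) i (mem_univ i)
        have h5 : ‖c x (α + β)‖ ≤ B := hbd x _ (by
          have := mem_multiIdx.1 hβ
          simp only [Pi.add_apply, sum_add_distrib]
          omega)
        have h6 : ‖y - x‖ ^ (∑ i, β i) ≤ ‖y - x‖ ^ t := by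
          refine (pow_le_of_le_one (norm_nonneg _) hr (by omega)).trans ?_
          rcases eq_or_ne ‖y - x‖ 0 with h0 | h0
          · rw [h0, Real.zero_rpow ht.ne']
          · have := Real.rpow_le_rpow_of_exponent_ge
              (lt_of_le_of_ne (norm_nonneg _) h0.symm) hr ht1
            rwa [Real.rpow_one] at this
        gcongr
    calc ‖c y α - c x α‖ ≤ K * ‖y - x‖ ^ t + D * B * ‖y - x‖ ^ t := by
          have := norm_sub_le_norm_sub_add_norm_sub (c y α) (shiftJet d (c x) (y - x) α) (c x α)
          linarith
      _ ≤ (2 * B + K + D * B) * ‖y - x‖ ^ t := by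
        have := mul_nonneg (mul_nonneg (zero_le_two : (0 : ℝ) ≤ 2) hB0) hr0
        linarith

end ConverseTaylor

/-! ### Functions with uniform polynomial approximations -/

/-- `h` is approximated at every point `x` by a polynomial of degree at most `d`, with error at
most `C * ‖y - x‖ ^ s` everywhere. -/
def JetApprox {n : ℕ} {F : Type*} [NormedAddCommGroup F] [NormedSpace ℝ F] (d : ℕ) (s C : ℝ)
    (h : EuclideanSpace ℝ (Fin n) → F) : Prop :=
  ∀ x, ∃ c : (Fin n → ℕ) → F, ∀ y, ‖h y - jetEval d c (y - x)‖ ≤ C * ‖y - x‖ ^ s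

section JetApprox

variable {n : ℕ} {F : Type*} [NormedAddCommGroup F] [NormedSpace ℝ F] {d : ℕ} {s C : ℝ}

theorem JetApprox.mono_const {C' : ℝ} {h : EuclideanSpace ℝ (Fin n) → F} (hh : JetApprox d s C h)
    (hC : C ≤ C') : JetApprox d s C' h := fun x => by
  obtain ⟨c, hc⟩ := hh x
  exact ⟨c, fun y => (hc y).trans
    (mul_le_mul_of_nonneg_right hC (Real.rpow_nonneg (norm_nonneg _) s))⟩

theorem jetApprox_zero : JetApprox d s 0 (fun _ : EuclideanSpace ℝ (Fin n) => (0 : F)) :=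
  fun x => ⟨0, fun y => by simp [jetEval_zero]⟩

theorem JetApprox.sum {ι : Type*} {I : Finset ι} {h : ι → EuclideanSpace ℝ (Fin n) → F}
    (hh : ∀ i ∈ I, JetApprox d s C (h i)) :
    JetApprox d s (I.card * C) (fun y => ∑ i ∈ I, h i y) := by
  classical
  induction I using Finset.induction_on with
  | empty => simpa using jetApprox_zero
  | insert i I hi ih =>
    intro x
    obtain ⟨c, hc⟩ := hh i (mem_insert_self i I) x
    obtain ⟨c', hc'⟩ := ih (fun j hj => hh j (mem_insert_of_mem hj)) x
    refine ⟨c + c', fun y => ?_⟩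
    beta_reduce
    rw [sum_insert hi, jetEval_add, card_insert_of_notMem hi, add_sub_add_comm]
    refine (norm_add_le _ _).trans ?_
    have h1 := hc y
    have h2 := hc' y
    push_cast
    linarith

theorem JetApprox.smul_vec {h : EuclideanSpace ℝ (Fin n) → ℝ} (hh : JetApprox d s C h) (v : F) :
    JetApprox d s (C * ‖v‖) (fun y => h y • v) := fun x => by
  obtain ⟨c, hc⟩ := hh x
  refine ⟨fun α => c α • v, fun y => ?_⟩
  have h1 : jetEval d (fun α => c α • v) (y - x) = jetEval d c (y - x) • v := by
    simp only [jetEval, sum_smul, smul_smul, smul_eq_mul]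
  rw [h1, ← sub_smul, norm_smul, mul_right_comm]
  exact mul_le_mul_of_nonneg_right (hc y) (norm_nonneg v)

theorem JetApprox.const_smul {h : EuclideanSpace ℝ (Fin n) → F} (hh : JetApprox d s C h) (a : ℝ) :
    JetApprox d s (|a| * C) (fun y => a • h y) := fun x => by
  obtain ⟨c, hc⟩ := hh x
  refine ⟨a • c, fun y => ?_⟩
  rw [jetEval_const_smul, ← smul_sub, norm_smul, mul_assoc]
  exact mul_le_mul_of_nonneg_left (hc y) (abs_nonneg a)

theorem JetApprox.comp_rescale {h : EuclideanSpace ℝ (Fin n) → F} (hh : JetApprox d s C h)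
    (b : EuclideanSpace ℝ (Fin n)) {r : ℝ} (hr : 0 < r) :
    JetApprox d s (C * r ^ s) (fun y => h (r • (y - b))) := fun x => by
  obtain ⟨c, hc⟩ := hh (r • (x - b))
  refine ⟨fun α => r ^ (∑ i, α i) • c α, fun y => ?_⟩
  have h1 := hc (r • (y - b))
  have h2 : r • (y - b) - r • (x - b) = r • (y - x) := by
    rw [← smul_sub]
    congr 1
    abel
  rwa [h2, jetEval_smul_vec, norm_smul, Real.norm_of_nonneg hr.le,
    Real.mul_rpow hr.le (norm_nonneg _), ← mul_assoc] at h1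

end JetApprox

/-! ### Uniform Taylor approximation of products of one-variable test functions. -/

theorem exists_taylor_bound_real {w : ℝ → ℝ} (hw : ContDiff ℝ (⊤ : ℕ∞) w)
    (hc : HasCompactSupport w) (d : ℕ) :
    ∃ C : ℝ, 1 ≤ C ∧ (∀ x, |w x| ≤ C) ∧ ∀ x, ∃ a : ℕ → ℝ, (∀ k ≤ d, |a k| ≤ C) ∧
      ∀ y, |w y - ∑ k ∈ range (d + 1), (y - x) ^ k / (k.factorial : ℝ) * a k|
        ≤ C * |y - x| ^ (d + 1) := by
  have hcs : ∀ k, HasCompactSupport (iteratedDeriv k w) := by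
    intro k
    induction k with
    | zero => simpa using hc
    | succ k ih =>
      rw [iteratedDeriv_succ]
      exact ih.deriv
  have hb : ∀ k, ∃ C, ∀ x, ‖iteratedDeriv k w x‖ ≤ C := fun k =>
    (hcs k).exists_bound_of_continuous (hw.continuous_iteratedDeriv k (by exact_mod_cast le_top))
  choose B hB using hb
  have hB0 : ∀ k, 0 ≤ B k := fun k => (norm_nonneg _).trans (hB k 0)
  set C := 1 + ∑ k ∈ range (d + 2), B k with hC
  have hBC : ∀ k ≤ d + 1, B k ≤ C := fun k hk => by
    have := single_le_sum (f := B) (fun k _ => hB0 k) (mem_range.2 (Nat.lt_succ_of_le hk))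
    linarith
  refine ⟨C, ?_, ?_, fun x => ⟨fun k => iteratedDeriv k w x, ?_, fun y => ?_⟩⟩
  · have : 0 ≤ ∑ k ∈ range (d + 2), B k := sum_nonneg fun k _ => hB0 k
    linarith
  · intro x
    have := (hB 0 x).trans (hBC 0 (Nat.zero_le _))
    simpa using this
  · exact fun k hk => (hB k x).trans (hBC k (by omega))
  · rcases eq_or_ne x y with rfl | hne
    · rw [sum_eq_single 0]
      · simp
      · intro k _ hk
        simp [hk]
      · simp
    · obtain ⟨x', -, hx'⟩ := taylor_mean_remainder_lagrange_iteratedDeriv (n := d) hne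
        (hw.of_le (by exact_mod_cast le_top)).contDiffOn
      have h1 : taylorWithinEval w d (Set.uIcc x y) x y
          = ∑ k ∈ range (d + 1), (y - x) ^ k / (k.factorial : ℝ) * iteratedDeriv k w x := by
        rw [taylor_within_apply]
        refine sum_congr rfl fun k _ => ?_
        rw [iteratedDerivWithin_eq_iteratedDeriv (uniqueDiffOn_uIcc hne)
          (hw.contDiffAt.of_le (by exact_mod_cast le_top)) Set.left_mem_uIcc, smul_eq_mul]
        ring
      rw [← h1, hx', abs_div, abs_mul, abs_pow, Nat.abs_cast]
      refine (div_le_self (by positivity)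
        (Nat.one_le_cast.2 (Nat.factorial_pos _))).trans ?_
      gcongr
      exact (hB _ _).trans (hBC _ le_rfl)

theorem abs_prod_sub_prod_le {ι : Type*} (I : Finset ι) {f g : ι → ℝ} {A ε : ℝ} (hA : 1 ≤ A)
    (hε : 0 ≤ ε) (hf : ∀ i ∈ I, |f i| ≤ A) (hg : ∀ i ∈ I, |g i| ≤ A)
    (hfg : ∀ i ∈ I, |f i - g i| ≤ ε) :
    |∏ i ∈ I, f i - ∏ i ∈ I, g i| ≤ I.card * A ^ I.card * ε := by
  classical
  induction I using Finset.induction_on with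
  | empty => simp
  | insert i I hi ih =>
    have h1 := ih (fun j hj => hf j (mem_insert_of_mem hj)) (fun j hj => hg j (mem_insert_of_mem hj))
      fun j hj => hfg j (mem_insert_of_mem hj)
    have h2 : |∏ j ∈ I, f j| ≤ A ^ I.card := by
      rw [abs_prod, ← prod_const]
      exact prod_le_prod (fun _ _ => abs_nonneg _) fun j hj => hf j (mem_insert_of_mem hj)
    rw [prod_insert hi, prod_insert hi, card_insert_of_notMem hi]
    have h3 : f i * ∏ j ∈ I, f j - g i * ∏ j ∈ I, g j
        = (f i - g i) * ∏ j ∈ I, f j + g i * (∏ j ∈ I, f j - ∏ j ∈ I, g j) := by ring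
    rw [h3]
    refine (abs_add_le _ _).trans ?_
    rw [abs_mul, abs_mul]
    have h4 : |f i - g i| * |∏ j ∈ I, f j| ≤ ε * A ^ I.card :=
      mul_le_mul (hfg i (mem_insert_self _ _)) h2 (abs_nonneg _) hε
    have h5 : |g i| * |∏ j ∈ I, f j - ∏ j ∈ I, g j| ≤ A * (I.card * A ^ I.card * ε) :=
      mul_le_mul (hg i (mem_insert_self _ _)) h1 (abs_nonneg _) (by linarith)
    have h6 : ε * A ^ I.card ≤ ε * A ^ (I.card + 1) :=
      mul_le_mul_of_nonneg_left (pow_le_pow_right₀ hA (Nat.le_succ _)) hε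
    push_cast
    calc _ ≤ ε * A ^ (I.card + 1) + A * (I.card * A ^ I.card * ε) := by linarith
      _ = _ := by ring

/-- The approximating polynomial is the product of the one-variable Taylor polynomials, cut off at
total degree `d`. For `|y - x| ≤ 1` the one-variable remainders and the discarded terms are `O(|y -
x| ^ (d + 1))`, which `s ≤ d + 1` absorbs. For `|y - x| ≥ 1` the product is bounded and the
polynomial is `O(|y - x| ^ d)`, which `d ≤ s` absorbs. -/
theorem exists_jetApprox_prod {n : ℕ} {w : Fin n → ℝ → ℝ}
    (hw : ∀ j, ContDiff ℝ (⊤ : ℕ∞) (w j)) (hc : ∀ j, HasCompactSupport (w j)) {d : ℕ} {s : ℝ}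
    (hs : 0 < s) (hds : d ≤ s) (hsd : s ≤ d + 1) :
    ∃ C : ℝ, 0 ≤ C ∧ JetApprox d s C (fun z : EuclideanSpace ℝ (Fin n) => ∏ j, w j (z j)) := by
  have h0 := fun j => exists_taylor_bound_real (hw j) (hc j) d
  choose B hB1 hBw hB using h0
  obtain ⟨A, hA1, hBA⟩ : ∃ A, 1 ≤ A ∧ ∀ j, B j ≤ A := by
    refine ⟨1 + ∑ j, B j, ?_, fun j => ?_⟩
    · have : 0 ≤ ∑ j, B j := sum_nonneg fun j _ => by linarith [hB1 j]
      linarith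
    · have := single_le_sum (f := B) (fun k _ => by linarith [hB1 k]) (mem_univ j)
      linarith
  have hA0 : 0 ≤ A := by linarith
  set A' := (d + 1) * A with hA'
  have hAA' : A ≤ A' := by
    rw [hA']
    have : (0 : ℝ) ≤ d * A := by positivity
    linarith
  set S := Fintype.piFinset fun _ : Fin n => range (d + 1) with hS
  set C1 := n * A' ^ n * A with hC1
  have hC10 : 0 ≤ C1 := by positivity
  set C2 := S.card * A ^ n with hC2
  have hC20 : 0 ≤ C2 := by positivity
  refine ⟨C1 + C2 + A ^ n, by positivity, fun x => ?_⟩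
  choose a ha1 ha using fun j => hB j (x j)
  have hcoef : ∀ α ∈ S, |∏ j, a j (α j)| ≤ A ^ n := fun α hα => by
    rw [abs_prod]
    calc ∏ j, |a j (α j)| ≤ ∏ _j : Fin n, A := prod_le_prod (fun _ _ => abs_nonneg _) fun j _ =>
          (ha1 j _ (Nat.le_of_lt_succ (mem_range.1 (Fintype.mem_piFinset.1 hα j)))).trans (hBA j)
      _ = A ^ n := by simp
  refine ⟨fun α => ∏ j, a j (α j), fun y => ?_⟩
  set v := y - x with hv
  have hr0 : 0 ≤ ‖v‖ ^ s := Real.rpow_nonneg (norm_nonneg _) s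
  have hsub : multiIdx n d ⊆ S := filter_subset _ _
  have hterm : ∀ α ∈ S, |mono α v • ∏ j, a j (α j)| ≤ ‖v‖ ^ (∑ i, α i) * A ^ n := fun α hα => by
    rw [smul_eq_mul, abs_mul]
    exact mul_le_mul (abs_mono_le α v) (hcoef α hα) (abs_nonneg _) (by positivity)
  rw [Real.norm_eq_abs]
  rcases le_total 1 ‖v‖ with h1 | h1
  · have h2 : |∏ j, w j (y j)| ≤ A ^ n := by
      rw [abs_prod]
      calc ∏ j, |w j (y j)| ≤ ∏ _j : Fin n, A := prod_le_prod (fun _ _ => abs_nonneg _) fun j _ =>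
            (hBw j _).trans (hBA j)
        _ = A ^ n := by simp
    have h3 : ‖v‖ ^ d ≤ ‖v‖ ^ s := by
      rw [← Real.rpow_natCast]
      exact Real.rpow_le_rpow_of_exponent_le h1 hds
    have h4 : |jetEval d (fun α => ∏ j, a j (α j)) v| ≤ C2 * ‖v‖ ^ s := by
      unfold jetEval
      refine (abs_sum_le_sum_abs _ _).trans ?_
      calc _ ≤ ∑ α ∈ multiIdx n d, ‖v‖ ^ s * A ^ n := sum_le_sum fun α hα => by
            refine (hterm α (hsub hα)).trans (mul_le_mul_of_nonneg_right ?_ (by positivity))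
            exact (pow_le_pow_right₀ h1 (mem_multiIdx.1 hα)).trans h3
        _ = (multiIdx n d).card * (‖v‖ ^ s * A ^ n) := by rw [sum_const, nsmul_eq_mul]
        _ ≤ S.card * (‖v‖ ^ s * A ^ n) := by gcongr
        _ = C2 * ‖v‖ ^ s := by rw [hC2]; ring
    have h5 : 1 ≤ ‖v‖ ^ s := Real.one_le_rpow h1 hs.le
    have h6 := abs_sub (∏ j, w j (y j)) (jetEval d (fun α => ∏ j, a j (α j)) v)
    have h7 : A ^ n * 1 ≤ A ^ n * ‖v‖ ^ s := by gcongr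
    have h8 : 0 ≤ C1 * ‖v‖ ^ s := by positivity
    linarith
  · have h2 : ‖v‖ ^ (d + 1) ≤ ‖v‖ ^ s := by
      rcases eq_or_ne ‖v‖ 0 with h0 | h0
      · rw [h0, Real.zero_rpow hs.ne', zero_pow (Nat.succ_ne_zero d)]
      · rw [← Real.rpow_natCast]
        refine Real.rpow_le_rpow_of_exponent_ge (lt_of_le_of_ne (norm_nonneg _) h0.symm) h1 ?_
        push_cast
        exact hsd
    have hvj : ∀ j, |v j| ≤ ‖v‖ := fun j => PiLp.norm_apply_le v j
    set p : Fin n → ℝ := fun j => ∑ k ∈ range (d + 1), v j ^ k / (k.factorial : ℝ) * a j k with hp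
    have hpA : ∀ j, |p j| ≤ A' := fun j => by
      rw [hp]
      refine (abs_sum_le_sum_abs _ _).trans ?_
      calc _ ≤ ∑ _k ∈ range (d + 1), A := sum_le_sum fun k hk => by
            rw [abs_mul, abs_div, abs_pow, Nat.abs_cast]
            have h3 : |v j| ^ k / (k.factorial : ℝ) ≤ 1 :=
              (div_le_self (by positivity)
                (Nat.one_le_cast.2 (Nat.factorial_pos _))).trans
                (pow_le_one₀ (abs_nonneg _) ((hvj j).trans h1))
            calc _ ≤ 1 * A := mul_le_mul h3
                  ((ha1 j k (Nat.le_of_lt_succ (mem_range.1 hk))).trans (hBA j))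
                  (abs_nonneg _) zero_le_one
              _ = A := one_mul A
        _ = A' := by rw [sum_const, card_range, nsmul_eq_mul, hA']; push_cast; ring
    have h3 : |∏ j, w j (y j) - ∏ j, p j| ≤ C1 * ‖v‖ ^ s := by
      have h4 := abs_prod_sub_prod_le (univ : Finset (Fin n)) (f := fun j => w j (y j)) (g := p)
        (A := A') (ε := A * ‖v‖ ^ s) (hA1.trans hAA') (by positivity)
        (fun j _ => (hBw j _).trans ((hBA j).trans hAA')) (fun j _ => hpA j) (fun j _ => ?_)
      · rw [card_univ, Fintype.card_fin] at h4
        refine h4.trans (le_of_eq ?_)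
        rw [hC1]; ring
      · refine (ha j (y j)).trans ?_
        have h5 : |y j - x j| ^ (d + 1) ≤ ‖v‖ ^ s :=
          (pow_le_pow_left₀ (abs_nonneg _) (hvj j) _).trans h2
        have := hBA j
        gcongr
    have h4 : ∏ j, p j = ∑ α ∈ S, mono α v • ∏ j, a j (α j) := by
      rw [hp, prod_univ_sum]
      refine sum_congr rfl fun α _ => ?_
      rw [prod_mul_distrib, smul_eq_mul, mono]
    have h5 : |∏ j, p j - jetEval d (fun α => ∏ j, a j (α j)) v| ≤ C2 * ‖v‖ ^ s := by
      rw [h4, jetEval, ← sum_sdiff hsub, add_sub_cancel_right]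
      refine (abs_sum_le_sum_abs _ _).trans ?_
      calc _ ≤ ∑ α ∈ S \ multiIdx n d, ‖v‖ ^ s * A ^ n := sum_le_sum fun α hα => by
            rw [Finset.mem_sdiff, mem_multiIdx, not_le] at hα
            refine (hterm α hα.1).trans (mul_le_mul_of_nonneg_right ?_ (by positivity))
            exact (pow_le_pow_of_le_one (norm_nonneg _) h1 hα.2).trans h2
        _ = (S \ multiIdx n d).card * (‖v‖ ^ s * A ^ n) := by rw [sum_const, nsmul_eq_mul]
        _ ≤ S.card * (‖v‖ ^ s * A ^ n) := by
          gcongr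
          exact sdiff_subset
        _ = C2 * ‖v‖ ^ s := by rw [hC2]; ring
    have h6 := abs_sub_le (∏ j, w j (y j)) (∏ j, p j) (jetEval d (fun α => ∏ j, a j (α j)) v)
    have h7 : 0 ≤ A ^ n * ‖v‖ ^ s := by positivity
    linarith

/-! ### A smooth partition of unity on the integer lattice -/

/-- A smooth function supported in `[-1, 1]` whose integer translates sum up to one. -/
def bump (t : ℝ) : ℝ := Real.smoothTransition (t + 1) - Real.smoothTransition t

theorem contDiff_bump : ContDiff ℝ (⊤ : ℕ∞) bump :=
  (Real.smoothTransition.contDiff.comp (contDiff_id.add contDiff_const)).sub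
    Real.smoothTransition.contDiff

theorem abs_lt_one_of_bump_ne_zero {t : ℝ} (h : bump t ≠ 0) : |t| < 1 := by
  by_contra hcon
  refine h ?_
  rcases le_abs.1 (not_lt.1 hcon) with h1 | h1
  · rw [bump, Real.smoothTransition.one_of_one_le h1,
      Real.smoothTransition.one_of_one_le (by linarith), sub_self]
  · rw [bump, Real.smoothTransition.zero_of_nonpos (by linarith),
      Real.smoothTransition.zero_of_nonpos (by linarith), sub_self]

theorem abs_bump_le_one (t : ℝ) : |bump t| ≤ 1 := by
  have h1 := Real.smoothTransition.nonneg t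
  have h2 := Real.smoothTransition.le_one t
  have h3 := Real.smoothTransition.nonneg (t + 1)
  have h4 := Real.smoothTransition.le_one (t + 1)
  rw [bump, abs_le]
  constructor <;> linarith

theorem hasCompactSupport_bump : HasCompactSupport bump :=
  HasCompactSupport.of_support_subset_isCompact (isCompact_Icc (a := (-1 : ℝ)) (b := 1))
    fun t ht => by
      have := abs_lt.1 (abs_lt_one_of_bump_ne_zero ht)
      exact ⟨this.1.le, this.2.le⟩

/-- Only `k = ⌊t⌋` and `k = ⌊t⌋ + 1` can contribute, and the differences defining these two bumps
telescope. -/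
theorem sum_bump_eq_one {t : ℝ} {I : Finset ℤ} (hI : ∀ k : ℤ, |t - k| < 1 → k ∈ I) :
    ∑ k ∈ I, bump (t - k) = 1 := by
  have h1 : ∑ k ∈ I, bump (t - k) = ∑ k ∈ {⌊t⌋, ⌊t⌋ + 1}, bump (t - k) := by
    symm
    have hf := Int.floor_le t
    have hf' := Int.lt_floor_add_one t
    by_cases h : |t - (⌊t⌋ + 1 : ℤ)| < 1
    · refine sum_subset ?_ ?_
      · intro k hk
        rw [mem_insert, mem_singleton] at hk
        rcases hk with rfl | rfl
        · exact hI _ (by rw [abs_lt]; constructor <;> linarith)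
        · exact hI _ h
      · intro k _ hk
        by_contra h2
        have h3 := abs_lt.1 (abs_lt_one_of_bump_ne_zero h2)
        refine hk ?_
        rw [mem_insert, mem_singleton]
        have h4 : k < ⌊t⌋ + 2 := by
          have : (k : ℝ) < (⌊t⌋ + 2 : ℤ) := by push_cast; linarith
          exact_mod_cast this
        have h5 : ⌊t⌋ - 1 < k := by
          have : ((⌊t⌋ - 1 : ℤ) : ℝ) < k := by push_cast; linarith
          exact_mod_cast this
        omega
    -- Here `t` is an integer, and `⌊t⌋ + 1` need not belong to `I`, but its bump vanishes.
    · have ht : t = ⌊t⌋ := by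
        rw [abs_lt] at h
        push_cast at h
        by_contra hne
        have : (⌊t⌋ : ℝ) < t := lt_of_le_of_ne hf (Ne.symm hne)
        exact h ⟨by linarith, by linarith⟩
      have h2 : ∑ k ∈ ({⌊t⌋, ⌊t⌋ + 1} : Finset ℤ), bump (t - k) = ∑ k ∈ {⌊t⌋}, bump (t - k) := by
        rw [sum_pair (by omega), sum_singleton]
        by_contra h3
        exact h (abs_lt_one_of_bump_ne_zero fun h4 => h3 (by rw [h4, add_zero]))
      rw [h2]
      refine sum_subset ?_ ?_
      · intro k hk
        rw [mem_singleton] at hk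
        subst hk
        exact hI _ (by rw [abs_lt]; constructor <;> linarith)
      · intro k _ hk
        by_contra h2
        have h3 := abs_lt.1 (abs_lt_one_of_bump_ne_zero h2)
        refine hk ?_
        rw [mem_singleton]
        rw [ht] at h3
        have h4 : k < ⌊t⌋ + 1 := by
          have : (k : ℝ) < (⌊t⌋ + 1 : ℤ) := by push_cast; linarith
          exact_mod_cast this
        have h5 : ⌊t⌋ - 1 < k := by
          have : ((⌊t⌋ - 1 : ℤ) : ℝ) < k := by push_cast; linarith
          exact_mod_cast this
        omega
  rw [h1, sum_pair (by omega)]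
  have hf := Int.floor_le t
  have hf' := Int.lt_floor_add_one t
  push_cast
  rw [bump, bump, Real.smoothTransition.one_of_one_le (by linarith),
    Real.smoothTransition.zero_of_nonpos (x := t - (⌊t⌋ + 1)) (by linarith),
    show t - (⌊t⌋ + 1) + 1 = t - ⌊t⌋ by ring]
  ring

/-- The product of the bumps of two consecutive dyadic scales, with relative position `θ`. -/
def kern {n : ℕ} (θ : Fin n → ℤ) (z : EuclideanSpace ℝ (Fin n)) : ℝ :=
  ∏ j, (bump (z j) * bump (2 * z j - θ j))

/-- If both bumps are nonzero then `|θ_j| < 1 + 2`. Hence only finitely many kernels matter, which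
is what makes the later constants independent of scale and position. -/
theorem kern_eq_zero {n : ℕ} {θ : Fin n → ℤ}
    (hθ : θ ∉ Fintype.piFinset fun _ : Fin n => Finset.Icc (-2 : ℤ) 2)
    (z : EuclideanSpace ℝ (Fin n)) : kern θ z = 0 := by
  rw [Fintype.mem_piFinset] at hθ
  push Not at hθ
  obtain ⟨j, hj⟩ := hθ
  refine prod_eq_zero (mem_univ j) ?_
  by_contra h
  have h1 := abs_lt.1 (abs_lt_one_of_bump_ne_zero (left_ne_zero_of_mul h))
  have h2 := abs_lt.1 (abs_lt_one_of_bump_ne_zero (right_ne_zero_of_mul h))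
  refine hj (Finset.mem_Icc.2 ⟨?_, ?_⟩)
  · have : ((-3 : ℤ) : ℝ) < θ j := by push_cast; linarith
    have : -3 < θ j := by exact_mod_cast this
    omega
  · have : (θ j : ℝ) < (3 : ℤ) := by push_cast; linarith
    have : θ j < 3 := by exact_mod_cast this
    omega

theorem exists_jetApprox_mono_mul_kern (n d : ℕ) {s : ℝ} (hs : 0 < s) (hds : d ≤ s)
    (hsd : s ≤ d + 1) :
    ∃ C : ℝ, 0 ≤ C ∧ ∀ (θ : Fin n → ℤ), ∀ β ∈ multiIdx n d,
      JetApprox d s C (fun z : EuclideanSpace ℝ (Fin n) => mono β z * kern θ z) := by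
  have h0 : ∀ (θ : Fin n → ℤ) (β : Fin n → ℕ), ∃ C : ℝ, 0 ≤ C ∧
      JetApprox d s C (fun z : EuclideanSpace ℝ (Fin n) => mono β z * kern θ z) := by
    intro θ β
    have h1 := exists_jetApprox_prod (n := n)
      (w := fun j t => t ^ β j / ((β j).factorial : ℝ) * (bump t * bump (2 * t - θ j)))
      (fun j => ?_) (fun j => ?_) hs hds hsd
    · obtain ⟨C, hC, h⟩ := h1
      refine ⟨C, hC, ?_⟩
      convert h using 2 with z
      rw [prod_mul_distrib, mono, kern]
    · have h2 : ContDiff ℝ (⊤ : ℕ∞) fun t => bump (2 * t - θ j) :=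
        contDiff_bump.comp ((contDiff_const.mul contDiff_id).sub contDiff_const)
      exact ((contDiff_id.pow _).div_const _).mul (contDiff_bump.mul h2)
    · exact (hasCompactSupport_bump.mul_right).mul_left
  choose C hC hh using h0
  refine ⟨∑ θ ∈ Fintype.piFinset fun _ : Fin n => Finset.Icc (-2 : ℤ) 2, ∑ β ∈ multiIdx n d, C θ β,
    sum_nonneg fun θ _ => sum_nonneg fun β _ => hC θ β, fun θ β hβ => ?_⟩
  by_cases hθ : θ ∈ Fintype.piFinset fun _ : Fin n => Finset.Icc (-2 : ℤ) 2
  · refine (hh θ β).mono_const ?_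
    refine (single_le_sum (f := fun β => C θ β) (fun β _ => hC θ β) hβ).trans ?_
    exact single_le_sum (f := fun θ => ∑ β ∈ multiIdx n d, C θ β)
      (fun θ _ => sum_nonneg fun β _ => hC θ β) hθ
  · have h2 : (fun z : EuclideanSpace ℝ (Fin n) => mono β z * kern θ z) = fun _ => 0 := by
      funext z
      rw [kern_eq_zero hθ, mul_zero]
    rw [h2]
    exact jetApprox_zero.mono_const (sum_nonneg fun θ _ => sum_nonneg fun β _ => hC θ β)

/-- Substituting `z = r (y - b)` turns the function into a combination of the fixed functions `mono
β z * kern θ z` with vectors `r⁻¹ ^ |β| • c β`, which the coefficient bound on the ball of radius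
`r⁻¹` controls by `M`. Undoing the substitution produces the factor `r ^ s`. -/
theorem exists_jetApprox_kern_smul (n m d : ℕ) {s : ℝ} (hs : 0 < s) (hds : d ≤ s)
    (hsd : s ≤ d + 1) :
    ∃ C : ℝ, 0 ≤ C ∧ ∀ (θ : Fin n → ℤ) (b : EuclideanSpace ℝ (Fin n))
      (c : (Fin n → ℕ) → EuclideanSpace ℝ (Fin m)) (r M : ℝ), 0 < r →
      (∀ v : EuclideanSpace ℝ (Fin n), ‖v‖ < r⁻¹ → ‖jetEval d c v‖ ≤ M) →
      JetApprox d s (C * M * r ^ s) (fun y => kern θ (r • (y - b)) • jetEval d c (y - b)) := by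
  obtain ⟨C, hC, h⟩ := exists_jetApprox_mono_mul_kern n d hs hds hsd
  obtain ⟨K, hK, hcoef⟩ := exists_coeff_bound_of_forall n m d
  refine ⟨(multiIdx n d).card * (C * K), by positivity, fun θ b c r M hr hM => ?_⟩
  have hM0 : 0 ≤ M := (norm_nonneg _).trans (hM 0 (by simpa))
  have h1 : JetApprox d s ((multiIdx n d).card * (C * (K * M))) (fun z =>
      ∑ β ∈ multiIdx n d, (mono β z * kern θ z) • (r⁻¹ ^ (∑ i, β i) • c β)) := by
    refine JetApprox.sum fun β hβ => ?_
    refine ((h θ β hβ).smul_vec _).mono_const (mul_le_mul_of_nonneg_left ?_ hC)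
    rw [norm_smul, norm_pow, Real.norm_of_nonneg (inv_pos.2 hr).le, mul_comm]
    exact hcoef c r⁻¹ M (inv_pos.2 hr) hM β (mem_multiIdx.1 hβ)
  have h2 := h1.comp_rescale b hr
  convert h2 using 1
  · ring
  · funext y
    have h3 : jetEval d c (y - b)
        = jetEval d (fun β => r⁻¹ ^ (∑ i, β i) • c β) (r • (y - b)) := by
      rw [← jetEval_smul_vec, inv_smul_smul₀ hr.ne']
    rw [h3, jetEval, smul_sum]
    refine sum_congr rfl fun β _ => ?_
    rw [smul_smul, mul_comm]

/-! ### A Whitney partition of unity off a closed set -/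

theorem norm_le_of_forall_abs_le {n : ℕ} {z : EuclideanSpace ℝ (Fin n)} {a : ℝ} (ha : 0 ≤ a)
    (h : ∀ j, |z j| ≤ a) : ‖z‖ ≤ n * a := by
  rw [EuclideanSpace.norm_eq]
  refine Real.sqrt_le_iff.2 ⟨by positivity, ?_⟩
  have h1 : ∀ j, ‖z j‖ ^ 2 ≤ a ^ 2 := fun j => pow_le_pow_left₀ (norm_nonneg _) (h j) 2
  calc ∑ j, ‖z j‖ ^ 2 ≤ ∑ _j : Fin n, a ^ 2 := sum_le_sum fun j _ => h1 j
    _ = n * a ^ 2 := by simp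
    _ ≤ (n : ℝ) ^ 2 * a ^ 2 := by
      refine mul_le_mul_of_nonneg_right ?_ (sq_nonneg a)
      exact_mod_cast Nat.le_self_pow two_ne_zero n
    _ = (n * a) ^ 2 := by ring

section Whitney

variable {n : ℕ}

/-- The points of the dyadic lattice of mesh `2⁻ⁱ`. -/
def latt (i : ℕ) (γ : Fin n → ℤ) : EuclideanSpace ℝ (Fin n) :=
  WithLp.toLp 2 fun j => (γ j : ℝ) / 2 ^ i

/-- The bump at scale `2⁻ⁱ` around a lattice point. -/
def tent (i : ℕ) (γ : Fin n → ℤ) (y : EuclideanSpace ℝ (Fin n)) : ℝ :=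
  ∏ j, bump (2 ^ i * y j - γ j)

open Classical in
/-- The indicator of the lattice points of mesh `2⁻ⁱ` which are close to `E`. -/
def sel (E : Set (EuclideanSpace ℝ (Fin n))) (i : ℕ) (γ : Fin n → ℤ) : ℝ :=
  if Metric.infDist (latt i γ) E ≤ 2 * n / 2 ^ i then 1 else 0

/-- The functions of the partition of unity, indexed by a scale, a point of the lattice at this
scale and a point of the lattice at the next scale. -/
def whitneyFun (E : Set (EuclideanSpace ℝ (Fin n))) (p : ℕ × (Fin n → ℤ) × (Fin n → ℤ))
    (y : EuclideanSpace ℝ (Fin n)) : ℝ :=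
  (sel E p.1 p.2.1 - sel E (p.1 + 1) p.2.2) * (tent p.1 p.2.1 y * tent (p.1 + 1) p.2.2 y)

theorem abs_lt_of_tent_ne_zero {i : ℕ} {γ : Fin n → ℤ} {y : EuclideanSpace ℝ (Fin n)}
    (h : tent i γ y ≠ 0) (j : Fin n) : |2 ^ i * y j - γ j| < 1 :=
  abs_lt_one_of_bump_ne_zero (prod_ne_zero_iff.1 h j (mem_univ j))

theorem abs_tent_le_one (i : ℕ) (γ : Fin n → ℤ) (y : EuclideanSpace ℝ (Fin n)) :
    |tent i γ y| ≤ 1 := by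
  rw [tent, abs_prod]
  exact prod_le_one (fun _ _ => abs_nonneg _) fun _ _ => abs_bump_le_one _

theorem norm_sub_latt_le {i : ℕ} {γ : Fin n → ℤ} {y : EuclideanSpace ℝ (Fin n)}
    (h : tent i γ y ≠ 0) : ‖y - latt i γ‖ ≤ n / 2 ^ i := by
  have h1 : ∀ j, |(y - latt i γ) j| ≤ 1 / 2 ^ i := fun j => by
    have h2 := abs_lt_of_tent_ne_zero h j
    have h3 : (y - latt i γ) j = (2 ^ i * y j - γ j) / 2 ^ i := by
      simp only [latt, PiLp.sub_apply]
      field_simp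
    rw [h3, abs_div, abs_of_pos (by positivity : (0 : ℝ) < 2 ^ i)]
    gcongr
  have := norm_le_of_forall_abs_le (by positivity) h1
  rwa [mul_one_div] at this

theorem sum_tent_eq_one {i : ℕ} {y : EuclideanSpace ℝ (Fin n)} {I : Finset ℤ}
    (hI : ∀ j, ∀ k : ℤ, |2 ^ i * y j - k| < 1 → k ∈ I) :
    ∑ γ ∈ Fintype.piFinset fun _ : Fin n => I, tent i γ y = 1 := by
  have h1 := prod_univ_sum (fun _ : Fin n => I) (fun j (k : ℤ) => bump (2 ^ i * y j - k))
  simp only [sum_bump_eq_one (hI _), prod_const_one] at h1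
  exact h1.symm

theorem sel_of_le {E : Set (EuclideanSpace ℝ (Fin n))} {i : ℕ} {γ : Fin n → ℤ}
    (h : Metric.infDist (latt i γ) E ≤ 2 * n / 2 ^ i) : sel E i γ = 1 := if_pos h

theorem sel_of_lt {E : Set (EuclideanSpace ℝ (Fin n))} {i : ℕ} {γ : Fin n → ℤ}
    (h : 2 * n / 2 ^ i < Metric.infDist (latt i γ) E) : sel E i γ = 0 := if_neg (not_le.2 h)

theorem sel_eq_zero_or_one (E : Set (EuclideanSpace ℝ (Fin n))) (i : ℕ) (γ : Fin n → ℤ) :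
    sel E i γ = 0 ∨ sel E i γ = 1 :=
  (le_or_gt (Metric.infDist (latt i γ) E) (2 * n / 2 ^ i)).elim (fun h => Or.inr (sel_of_le h))
    fun h => Or.inl (sel_of_lt h)

theorem le_of_sel_ne_zero {E : Set (EuclideanSpace ℝ (Fin n))} {i : ℕ} {γ : Fin n → ℤ}
    (h : sel E i γ ≠ 0) : Metric.infDist (latt i γ) E ≤ 2 * n / 2 ^ i := by
  by_contra hcon
  exact h (sel_of_lt (not_le.1 hcon))

theorem abs_sel_sub_sel_le (E : Set (EuclideanSpace ℝ (Fin n))) (i i' : ℕ) (γ γ' : Fin n → ℤ) :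
    |sel E i γ - sel E i' γ'| ≤ 1 := by
  rcases sel_eq_zero_or_one E i γ with h | h <;> rcases sel_eq_zero_or_one E i' γ' with h' | h' <;>
    simp [h, h']

theorem abs_whitneyFun_le_one (E : Set (EuclideanSpace ℝ (Fin n)))
    (p : ℕ × (Fin n → ℤ) × (Fin n → ℤ)) (y : EuclideanSpace ℝ (Fin n)) :
    |whitneyFun E p y| ≤ 1 := by
  rw [whitneyFun, abs_mul, abs_mul]
  exact mul_le_one₀ (abs_sel_sub_sel_le _ _ _ _ _) (by positivity)
    (mul_le_one₀ (abs_tent_le_one _ _ _) (abs_nonneg _) (abs_tent_le_one _ _ _))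

/-- This follows from `2^(i+1) y - γ' = 2 (2^i y - γ) - (γ' - 2 γ)`. Up to a bounded factor every
member of the partition is thus a rescaled kernel. -/
theorem whitneyFun_eq_kern (E : Set (EuclideanSpace ℝ (Fin n)))
    (p : ℕ × (Fin n → ℤ) × (Fin n → ℤ)) (y : EuclideanSpace ℝ (Fin n)) :
    whitneyFun E p y = (sel E p.1 p.2.1 - sel E (p.1 + 1) p.2.2) *
      kern (fun j => p.2.2 j - 2 * p.2.1 j) ((2 : ℝ) ^ p.1 • (y - latt p.1 p.2.1)) := by
  rw [whitneyFun, kern, tent, tent, ← prod_mul_distrib]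
  congr 1
  refine prod_congr rfl fun j _ => ?_
  have h1 : ((2 : ℝ) ^ p.1 • (y - latt p.1 p.2.1)) j = 2 ^ p.1 * y j - p.2.1 j := by
    simp only [latt, PiLp.smul_apply, PiLp.sub_apply, smul_eq_mul]
    field_simp
  rw [h1]
  congr 2
  push_cast
  ring

/-- If the difference of the two selectors is nonzero, one of two lattice points near `y` is close
to `E` and the other is not, so `y` lies at distance comparable to the scale. -/
theorem infDist_bounds_of_whitneyFun_ne_zero {E : Set (EuclideanSpace ℝ (Fin n))}
    {p : ℕ × (Fin n → ℤ) × (Fin n → ℤ)} {y : EuclideanSpace ℝ (Fin n)}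
    (h : whitneyFun E p y ≠ 0) :
    (n : ℝ) / 2 ^ p.1 ≤ 2 * Metric.infDist y E ∧ Metric.infDist y E ≤ 3 * (n / 2 ^ p.1) := by
  have h1 := left_ne_zero_of_mul h
  have h2 := norm_sub_latt_le (left_ne_zero_of_mul (right_ne_zero_of_mul h))
  have h3 := norm_sub_latt_le (right_ne_zero_of_mul (right_ne_zero_of_mul h))
  rw [← dist_eq_norm] at h2 h3
  have e1 := Metric.infDist_le_infDist_add_dist (x := y) (y := latt p.1 p.2.1) (s := E)
  have e2 := Metric.infDist_le_infDist_add_dist (y := y) (x := latt p.1 p.2.1) (s := E)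
  have e3 := Metric.infDist_le_infDist_add_dist (x := y) (y := latt (p.1 + 1) p.2.2) (s := E)
  have e4 := Metric.infDist_le_infDist_add_dist (y := y) (x := latt (p.1 + 1) p.2.2) (s := E)
  rw [dist_comm] at e2 e4
  have h4 : (n : ℝ) / 2 ^ (p.1 + 1) = (n / 2 ^ p.1) / 2 := by
    rw [pow_succ]
    field_simp
  have h5 : (2 * n : ℝ) / 2 ^ (p.1 + 1) = n / 2 ^ p.1 := by
    rw [pow_succ]
    field_simp
  have h6 : (2 * n : ℝ) / 2 ^ p.1 = 2 * (n / 2 ^ p.1) := by ring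
  have hpos : (0 : ℝ) ≤ n / 2 ^ p.1 := by positivity
  rw [h4] at h3
  rcases le_or_gt (Metric.infDist (latt p.1 p.2.1) E) (2 * n / 2 ^ p.1) with ha | ha <;>
    rcases le_or_gt (Metric.infDist (latt (p.1 + 1) p.2.2) E) (2 * n / 2 ^ (p.1 + 1)) with hb | hb
  · rw [sel_of_le ha, sel_of_le hb, sub_self] at h1
    exact absurd rfl h1
  · rw [h6] at ha
    rw [h5] at hb
    constructor <;> linarith
  · rw [h6] at ha
    rw [h5] at hb
    constructor <;> linarith
  · rw [sel_of_lt ha, sel_of_lt hb, sub_self] at h1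
    exact absurd rfl h1

theorem norm_sub_latt_le_of_whitneyFun_ne_zero {E : Set (EuclideanSpace ℝ (Fin n))}
    {p : ℕ × (Fin n → ℤ) × (Fin n → ℤ)} {y : EuclideanSpace ℝ (Fin n)}
    (h : whitneyFun E p y ≠ 0) : ‖y - latt p.1 p.2.1‖ ≤ n / 2 ^ p.1 :=
  norm_sub_latt_le (left_ne_zero_of_mul (right_ne_zero_of_mul h))

/-- Let `F_i` be the sum over `γ` of `sel E i γ * tent i γ`. Since the tents of each scale sum to
one, the members at scale `i` sum to `F_i - F_{i+1}`, and the total telescopes. `F_0 = 1` because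
every point is within `1 ≤ 2 * n` of `E`, and `F_M` vanishes at `y` once `3 * n / 2 ^ M` is below
the distance of `y` to `E`. -/
theorem sum_whitneyFun_eq_one (hn : 0 < n) {E : Set (EuclideanSpace ℝ (Fin n))}
    (hE : ∀ y, Metric.infDist y E ≤ 1) {y : EuclideanSpace ℝ (Fin n)}
    (hy : 0 < Metric.infDist y E) {I : Finset (ℕ × (Fin n → ℤ) × (Fin n → ℤ))}
    (hI : ∀ p, whitneyFun E p y ≠ 0 → p ∈ I) : ∑ p ∈ I, whitneyFun E p y = 1 := by
  have hn1 : (1 : ℝ) ≤ n := by exact_mod_cast hn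
  obtain ⟨M, hM⟩ := exists_pow_lt_of_lt_one (div_pos hy (by positivity : (0 : ℝ) < 3 * n))
    (by norm_num : (1 / 2 : ℝ) < 1)
  have hM' : ∀ i, M ≤ i → 3 * (n / 2 ^ i : ℝ) < Metric.infDist y E := fun i hi => by
    rw [lt_div_iff₀ (by positivity)] at hM
    have h1 : (1 / 2 : ℝ) ^ i ≤ (1 / 2) ^ M :=
      pow_le_pow_of_le_one (by norm_num) (by norm_num) hi
    calc 3 * (n / 2 ^ i : ℝ) = (1 / 2) ^ i * (3 * n) := by
          rw [one_div, inv_pow]; ring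
      _ ≤ (1 / 2) ^ M * (3 * n) := by gcongr
      _ < _ := hM
  obtain ⟨L, hL⟩ := exists_nat_ge (2 ^ M * ‖y‖ + 1)
  set J : Finset ℤ := Finset.Icc (-(L : ℤ)) L with hJ
  have hJmem : ∀ i ≤ M, ∀ j, ∀ k : ℤ, |2 ^ i * y j - k| < 1 → k ∈ J := by
    intro i hi j k hk
    have h1 : |2 ^ i * y j| ≤ 2 ^ M * ‖y‖ := by
      rw [abs_mul, abs_of_pos (by positivity : (0 : ℝ) < 2 ^ i)]
      exact mul_le_mul (pow_le_pow_right₀ (by norm_num) hi) (PiLp.norm_apply_le y j)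
        (abs_nonneg _) (by positivity)
    have h2 := abs_le.1 h1
    have h3 := abs_lt.1 hk
    rw [hJ, Finset.mem_Icc]
    constructor
    · have : ((-(L : ℤ) : ℤ) : ℝ) ≤ k := by push_cast; linarith
      exact_mod_cast this
    · have : (k : ℝ) ≤ ((L : ℤ) : ℝ) := by push_cast; linarith
      exact_mod_cast this
  set G : Finset (Fin n → ℤ) := Fintype.piFinset fun _ => J with hG
  have hGmem : ∀ i ≤ M, ∀ γ, tent i γ y ≠ 0 → γ ∈ G := fun i hi γ hγ =>
    Fintype.mem_piFinset.2 fun j => hJmem i hi j _ (abs_lt_of_tent_ne_zero hγ j)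
  have h1 : ∑ p ∈ I, whitneyFun E p y = ∑ p ∈ range M ×ˢ (G ×ˢ G), whitneyFun E p y := by
    rw [← finsum_eq_sum_of_support_subset _ (s := I) (fun p hp => hI p hp),
      ← finsum_eq_sum_of_support_subset _ (s := range M ×ˢ (G ×ˢ G)) (fun p hp => ?_)]
    have hp' : whitneyFun E p y ≠ 0 := hp
    have hlt : p.1 < M := by
      by_contra hcon
      have := hM' _ (not_lt.1 hcon)
      linarith [(infDist_bounds_of_whitneyFun_ne_zero hp').2]
    rw [mem_coe, mem_product, mem_product, mem_range]
    exact ⟨hlt, hGmem _ hlt.le _ (left_ne_zero_of_mul (right_ne_zero_of_mul hp')),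
      hGmem _ hlt _ (right_ne_zero_of_mul (right_ne_zero_of_mul hp'))⟩
  have hone : ∀ i ≤ M, ∑ γ ∈ G, tent i γ y = 1 := fun i hi => sum_tent_eq_one (hJmem i hi)
  have h2 : ∀ i < M, ∑ q ∈ G ×ˢ G, whitneyFun E (i, q) y
      = ∑ γ ∈ G, sel E i γ * tent i γ y - ∑ γ ∈ G, sel E (i + 1) γ * tent (i + 1) γ y := by
    intro i hi
    rw [sum_product]
    have h3 : ∀ γ ∈ G, ∑ γ' ∈ G, whitneyFun E (i, γ, γ') y = sel E i γ * tent i γ y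
        - tent i γ y * ∑ γ' ∈ G, sel E (i + 1) γ' * tent (i + 1) γ' y := by
      intro γ _
      have h4 : ∀ γ' ∈ G, whitneyFun E (i, γ, γ') y = sel E i γ * tent i γ y * tent (i + 1) γ' y
          - tent i γ y * (sel E (i + 1) γ' * tent (i + 1) γ' y) := fun γ' _ => by
        simp only [whitneyFun]
        ring
      rw [sum_congr rfl h4, sum_sub_distrib, ← mul_sum, ← mul_sum, hone _ hi, mul_one]
    rw [sum_congr rfl h3, sum_sub_distrib, ← sum_mul, hone _ hi.le, one_mul]
  rw [h1, sum_product, sum_congr rfl fun i hi => h2 i (mem_range.1 hi), sum_range_sub']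
  have h5 : ∑ γ ∈ G, sel E 0 γ * tent 0 γ y = 1 := by
    rw [← hone 0 (Nat.zero_le _)]
    refine sum_congr rfl fun γ _ => ?_
    rw [sel_of_le, one_mul]
    refine (hE _).trans ?_
    simp only [pow_zero, div_one]
    linarith
  have h6 : ∑ γ ∈ G, sel E M γ * tent M γ y = 0 := by
    refine sum_eq_zero fun γ _ => ?_
    by_contra hcon
    have h7 := le_of_sel_ne_zero (left_ne_zero_of_mul hcon)
    have h8 := norm_sub_latt_le (right_ne_zero_of_mul hcon)
    rw [← dist_eq_norm] at h8
    have h9 := Metric.infDist_le_infDist_add_dist (x := y) (y := latt M γ) (s := E)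
    have h10 := hM' M le_rfl
    rw [mul_div_assoc] at h7
    linarith
  rw [h5, h6, sub_zero]

/-- Members active near `x` have `n / 2 ^ i` between `δ / 6` and `4 * δ`, a ratio of `24 < 2 ^ 5`,
which allows five scales. At such a scale the radius `δ / (6 * n)` moves the coordinates of `2 ^ i •
y` by at most one, and by at most two at the next scale, so lattice coordinates lie within four of
the integer parts of those of `x`. -/
theorem exists_card_support_le (hn : 0 < n) :
    ∃ N : ℕ, ∀ (E : Set (EuclideanSpace ℝ (Fin n))) (x : EuclideanSpace ℝ (Fin n)),
      0 < Metric.infDist x E → ∃ I : Finset (ℕ × (Fin n → ℤ) × (Fin n → ℤ)), I.card ≤ N ∧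
        (∀ p, (∃ y, ‖y - x‖ ≤ Metric.infDist x E / (6 * n) ∧ whitneyFun E p y ≠ 0) ↔ p ∈ I) := by
  classical
  have hn1 : (1 : ℝ) ≤ n := by exact_mod_cast hn
  set G : Finset (Fin n → ℤ) := Fintype.piFinset fun _ => Finset.Icc (-4 : ℤ) 4 with hG
  refine ⟨(range 5 ×ˢ (G ×ˢ G)).card, fun E x hx => ?_⟩
  set δ := Metric.infDist x E with hδ
  obtain ⟨M, hM⟩ := exists_pow_lt_of_lt_one (div_pos (mul_pos four_pos hx)
    (by positivity : (0 : ℝ) < n)) (by norm_num : (1 / 2 : ℝ) < 1)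
  have hex : ∃ i : ℕ, (n / 2 ^ i : ℝ) ≤ 4 * δ := by
    refine ⟨M, ?_⟩
    rw [lt_div_iff₀ (by positivity), one_div, inv_pow] at hM
    rw [div_eq_mul_inv, mul_comm]
    exact hM.le
  set i₀ := Nat.find hex with hi₀
  have hi₀' : (n / 2 ^ i₀ : ℝ) ≤ 4 * δ := Nat.find_spec hex
  set T : ℕ × (Fin n → ℤ) × (Fin n → ℤ) → ℕ × (Fin n → ℤ) × (Fin n → ℤ) := fun q =>
    (i₀ + q.1, fun j => q.2.1 j + ⌊2 ^ (i₀ + q.1) * x j⌋,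
      fun j => q.2.2 j + ⌊2 ^ (i₀ + q.1 + 1) * x j⌋) with hT
  have hsub : ∀ p, (∃ y, ‖y - x‖ ≤ δ / (6 * n) ∧ whitneyFun E p y ≠ 0) →
      p ∈ (range 5 ×ˢ (G ×ˢ G)).image T := by
    rintro ⟨i, γ, γ'⟩ ⟨y, hyx, hp⟩
    obtain ⟨h1, h2⟩ := infDist_bounds_of_whitneyFun_ne_zero hp
    simp only at h1 h2
    have hyx2 : ‖y - x‖ ≤ δ / 6 := hyx.trans
      (div_le_div_of_nonneg_left hx.le (by norm_num) (by linarith))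
    have e1 := Metric.infDist_le_infDist_add_dist (x := y) (y := x) (s := E)
    have e2 := Metric.infDist_le_infDist_add_dist (y := y) (x := x) (s := E)
    rw [dist_comm] at e2
    rw [dist_eq_norm, ← hδ] at e1 e2
    have h3 : (n / 2 ^ i : ℝ) ≤ 4 * δ := by linarith
    have h4 : δ ≤ 6 * (n / 2 ^ i : ℝ) := by linarith
    have hle : i₀ ≤ i := Nat.find_min' hex h3
    have hlt : i < i₀ + 5 := by
      by_contra hcon
      have h5 : (2 : ℝ) ^ (i₀ + 5) ≤ 2 ^ i := pow_le_pow_right₀ (by norm_num) (not_lt.1 hcon)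
      have h6 : (n / 2 ^ i : ℝ) ≤ n / 2 ^ (i₀ + 5) := by gcongr
      have h7 : (n / 2 ^ (i₀ + 5) : ℝ) = (n / 2 ^ i₀) / 32 := by
        rw [pow_add]
        field_simp
        norm_num
      linarith
    have hxy : ∀ j, 2 ^ i * |y j - x j| ≤ 1 := fun j => by
      have h5 : |y j - x j| ≤ δ / (6 * n) := (PiLp.norm_apply_le (y - x) j).trans hyx
      calc 2 ^ i * |y j - x j| ≤ 2 ^ i * (δ / (6 * n)) := by gcongr
        _ ≤ 2 ^ i * ((6 * (n / 2 ^ i : ℝ)) / (6 * n)) := by gcongr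
        _ = 1 := by field_simp
    have hγ : ∀ j, |2 ^ i * y j - γ j| < 1 :=
      abs_lt_of_tent_ne_zero (left_ne_zero_of_mul (right_ne_zero_of_mul hp))
    have hγ' : ∀ j, |2 ^ (i + 1) * y j - γ' j| < 1 :=
      abs_lt_of_tent_ne_zero (right_ne_zero_of_mul (right_ne_zero_of_mul hp))
    have hint : ∀ (k : ℤ) (a w : ℝ), |a - k| < 1 → |a - w| ≤ 2 →
        k - ⌊w⌋ ∈ Finset.Icc (-4 : ℤ) 4 := by
      intro k a w hk hw
      have h5 := abs_lt.1 hk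
      have h6 := abs_le.1 hw
      have h7 := Int.floor_le w
      have h8 := Int.lt_floor_add_one w
      rw [Finset.mem_Icc]
      constructor
      · have : ((-4 : ℤ) : ℝ) ≤ ((k - ⌊w⌋ : ℤ) : ℝ) := by push_cast; linarith
        exact_mod_cast this
      · have : ((k - ⌊w⌋ : ℤ) : ℝ) ≤ ((4 : ℤ) : ℝ) := by push_cast; linarith
        exact_mod_cast this
    obtain ⟨k, rfl⟩ := Nat.exists_eq_add_of_le hle
    refine mem_image.2 ⟨(k, fun j => γ j - ⌊2 ^ (i₀ + k) * x j⌋,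
      fun j => γ' j - ⌊2 ^ (i₀ + k + 1) * x j⌋), ?_, ?_⟩
    · rw [mem_product, mem_product, mem_range]
      refine ⟨by omega, Fintype.mem_piFinset.2 fun j => ?_, Fintype.mem_piFinset.2 fun j => ?_⟩
      · refine hint _ _ _ (hγ j) ?_
        rw [← mul_sub, abs_mul, abs_of_pos (by positivity : (0 : ℝ) < 2 ^ (i₀ + k))]
        linarith [hxy j]
      · refine hint _ _ _ (hγ' j) ?_
        rw [← mul_sub, abs_mul, abs_of_pos (by positivity : (0 : ℝ) < 2 ^ (i₀ + k + 1)), pow_succ]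
        linarith [hxy j]
    · simp [hT]
  refine ⟨((range 5 ×ˢ (G ×ˢ G)).image T).filter
    fun p => ∃ y, ‖y - x‖ ≤ δ / (6 * n) ∧ whitneyFun E p y ≠ 0,
    (card_filter_le _ _).trans card_image_le, fun p => ?_⟩
  rw [mem_filter]
  exact ⟨fun h => ⟨hsub p h, h⟩, fun h => h.2⟩

end Whitney

/-! ### The Whitney extension theorem for Hölder jets -/

/-- A field of polynomials on a closed set which is compatible to order `s` is the restriction of
the Taylor polynomials of a function with uniform approximations of order `s`. -/
theorem exists_whitney_extension {n : ℕ} (hn : 0 < n) (m d : ℕ) {s : ℝ} (hs : 0 < s)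
    (hds : d ≤ s) (hsd : s ≤ d + 1) {E : Set (EuclideanSpace ℝ (Fin n))} (hE : IsClosed E)
    (hEne : E.Nonempty) (hE1 : ∀ y, Metric.infDist y E ≤ 1)
    {P : EuclideanSpace ℝ (Fin n) → (Fin n → ℕ) → EuclideanSpace ℝ (Fin m)} {W : ℝ} (hW0 : 0 ≤ W)
    (hW : ∀ x ∈ E, ∀ z ∈ E, ∀ y, ‖jetEval d (P x) (y - x) - jetEval d (P z) (y - z)‖
      ≤ W * (‖y - x‖ + ‖y - z‖) ^ s) :
    ∃ (u : EuclideanSpace ℝ (Fin n) → EuclideanSpace ℝ (Fin m)) (C : ℝ), 0 ≤ C ∧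
      (∀ x ∈ E, ∀ y, ‖u y - jetEval d (P x) (y - x)‖ ≤ C * ‖y - x‖ ^ s) ∧
      JetApprox d s C u := by
  classical
  have hn1 : (1 : ℝ) ≤ n := by exact_mod_cast hn
  obtain ⟨N, hN⟩ := exists_card_support_le hn
  obtain ⟨A, hA0, hA⟩ := exists_jetApprox_kern_smul n m d hs hds hsd
  have hnear : ∀ b : EuclideanSpace ℝ (Fin n), ∃ a ∈ E, ‖b - a‖ = Metric.infDist b E := fun b => by
    obtain ⟨a, ha, hab⟩ := hE.exists_infDist_eq_dist hEne b
    exact ⟨a, ha, by rw [hab, dist_eq_norm]⟩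
  choose π hπE hπ using hnear
  have hpos : ∀ y, y ∉ E → 0 < Metric.infDist y E := fun y hy =>
    (hE.notMem_iff_infDist_pos hEne).1 hy
  set a : ℕ × (Fin n → ℤ) × (Fin n → ℤ) → EuclideanSpace ℝ (Fin n) :=
    fun p => π (latt p.1 p.2.1) with ha
  set pol : EuclideanSpace ℝ (Fin n) → EuclideanSpace ℝ (Fin n) → EuclideanSpace ℝ (Fin m) :=
    fun x y => jetEval d (P x) (y - x) with hpol
  have hWp : ∀ x ∈ E, ∀ z ∈ E, ∀ y, ‖pol x y - pol z y‖ ≤ W * (‖y - x‖ + ‖y - z‖) ^ s := hW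
  have haE : ∀ p, a p ∈ E := fun p => hπE _
  set u : EuclideanSpace ℝ (Fin n) → EuclideanSpace ℝ (Fin m) := fun y =>
    if y ∈ E then pol y y else ∑ᶠ p, whitneyFun E p y • pol (a p) y with hu
  -- The weights sum to one, so any fixed vector `q` may be subtracted inside the sum. Differences
  -- of polynomials then appear, to which compatibility applies.
  have huI : ∀ y ∉ E, ∀ I : Finset (ℕ × (Fin n → ℤ) × (Fin n → ℤ)),
      (∀ p, whitneyFun E p y ≠ 0 → p ∈ I) → ∀ q, u y - q
        = ∑ p ∈ I, whitneyFun E p y • (pol (a p) y - q) := by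
    intro y hy I hI q
    have h1 : u y = ∑ p ∈ I, whitneyFun E p y • pol (a p) y := by
      rw [hu]
      simp only [hy, if_false]
      exact finsum_eq_sum_of_support_subset _ fun p hp => hI p fun h0 => hp (by simp [h0])
    simp only [smul_sub]
    rw [sum_sub_distrib, ← sum_smul, sum_whitneyFun_eq_one hn hE1 (hpos y hy) hI, one_smul, h1]
  -- the distance from the points of the support of a function to the point it is attached to
  have hdist : ∀ p y, whitneyFun E p y ≠ 0 → ‖y - a p‖ ≤ 5 * Metric.infDist y E := by
    intro p y hp
    have h1 := (infDist_bounds_of_whitneyFun_ne_zero hp).1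
    have h2 := norm_sub_latt_le_of_whitneyFun_ne_zero hp
    have h3 := hπ (latt p.1 p.2.1)
    have h4 := Metric.infDist_le_infDist_add_dist (y := y) (x := latt p.1 p.2.1) (s := E)
    rw [dist_comm, dist_eq_norm] at h4
    have h5 := norm_sub_le_norm_sub_add_norm_sub y (latt p.1 p.2.1) (a p)
    linarith
  -- The constant `6` is `5 + 1`: `|y - a p|` is at most five times the distance of `y` to `E`,
  -- which is at most `|y - x|`.
  set C1 := W + N * (W * 6 ^ s) with hC1
  have hC10 : 0 ≤ C1 := by positivity
  have hmain : ∀ x ∈ E, ∀ y, ‖u y - pol x y‖ ≤ C1 * ‖y - x‖ ^ s := by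
    intro x hx y
    by_cases hy : y ∈ E
    · have h1 : u y = pol y y := by
        rw [hu]
        simp only [hy, if_true]
      have h2 := hWp y hy x hx y
      rw [sub_self, norm_zero, zero_add] at h2
      rw [h1]
      refine h2.trans ?_
      gcongr
      rw [hC1]
      exact le_add_of_nonneg_right (by positivity)
    · obtain ⟨I, hIN, hI⟩ := hN E y (hpos y hy)
      have hI' : ∀ p, whitneyFun E p y ≠ 0 → p ∈ I := fun p hp =>
        (hI p).1 ⟨y, by rw [sub_self, norm_zero]; have := hpos y hy; positivity, hp⟩
      rw [huI y hy I hI']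
      refine (norm_sum_le _ _).trans ?_
      have hδ : Metric.infDist y E ≤ ‖y - x‖ := by
        rw [← dist_eq_norm]
        exact Metric.infDist_le_dist_of_mem hx
      have hterm : ∀ p ∈ I, ‖whitneyFun E p y • (pol (a p) y - pol x y)‖
          ≤ W * 6 ^ s * ‖y - x‖ ^ s := by
        intro p _
        by_cases hp : whitneyFun E p y = 0
        · rw [hp, zero_smul, norm_zero]
          positivity
        · have h1 := hdist p y hp
          rw [norm_smul, Real.norm_eq_abs]
          have h2 := hWp (a p) (haE p) x hx y
          have h3 : (‖y - a p‖ + ‖y - x‖) ^ s ≤ 6 ^ s * ‖y - x‖ ^ s := by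
            rw [← Real.mul_rpow (by norm_num) (norm_nonneg _)]
            exact Real.rpow_le_rpow (by positivity) (by linarith) hs.le
          calc _ ≤ 1 * ‖pol (a p) y - pol x y‖ := by
                gcongr
                exact abs_whitneyFun_le_one E p y
            _ ≤ W * (6 ^ s * ‖y - x‖ ^ s) := by
              rw [one_mul]
              exact h2.trans (by gcongr)
            _ = _ := by ring
      calc _ ≤ I.card • (W * 6 ^ s * ‖y - x‖ ^ s) := sum_le_card_nsmul _ _ _ hterm
        _ ≤ C1 * ‖y - x‖ ^ s := by
          rw [nsmul_eq_mul, ← mul_assoc]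
          gcongr
          rw [hC1]
          have : (I.card : ℝ) * (W * 6 ^ s) ≤ N * (W * 6 ^ s) := by gcongr
          linarith
  set C3 := N * (A * (W * 20 ^ s) * (6 * n) ^ s) with hC3
  have hC30 : 0 ≤ C3 := by positivity
  set C4 := N * (W * 20 ^ s) with hC4
  have hC40 : 0 ≤ C4 := by positivity
  set C5 := C1 * (1 + 6 * n) ^ s + C4 * (6 * n) ^ s with hC5
  have hC50 : 0 ≤ C5 := by positivity
  refine ⟨u, C1 + C3 + C5, by positivity, fun x hx y => (hmain x hx y).trans ?_, fun x => ?_⟩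
  · gcongr
    linarith
  by_cases hx : x ∈ E
  · refine ⟨P x, fun y => (hmain x hx y).trans ?_⟩
    gcongr
    linarith
  -- Off `E`, the function `u` is compared with the polynomial of the nearest point `π x` plus the
  -- finite sum `V` over the members active near `x`. The coefficients of these members are of size
  -- `δ ^ s` and their kernels vary at scale comparable to `δ`, so `δ` cancels from the constant in
  -- the jet approximation of `V`.
  set δ := Metric.infDist x E with hδ
  have hδ0 : 0 < δ := hpos x hx
  obtain ⟨I, hIN, hI⟩ := hN E x hδ0
  have hgeom : ∀ p ∈ I, δ ≤ 6 * n * (1 / 2 ^ p.1) ∧ ∀ y, ‖y - latt p.1 p.2.1‖ ≤ n / 2 ^ p.1 →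
      ‖pol (a p) y - pol (π x) y‖ ≤ W * 20 ^ s * δ ^ s := by
    intro p hp
    obtain ⟨z, hzx, hpz⟩ := (hI p).2 hp
    obtain ⟨h1, h2⟩ := infDist_bounds_of_whitneyFun_ne_zero hpz
    have h3 := norm_sub_latt_le_of_whitneyFun_ne_zero hpz
    have hzx2 : ‖z - x‖ ≤ δ / 6 := hzx.trans
      (div_le_div_of_nonneg_left hδ0.le (by norm_num) (by linarith))
    have e1 := Metric.infDist_le_infDist_add_dist (x := z) (y := x) (s := E)
    have e2 := Metric.infDist_le_infDist_add_dist (y := z) (x := x) (s := E)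
    have e3 := Metric.infDist_le_infDist_add_dist (y := z) (x := latt p.1 p.2.1) (s := E)
    rw [dist_comm] at e2 e3
    rw [dist_eq_norm] at e1 e2 e3
    rw [← hδ] at e1 e2
    have h4 : (6 * n * (1 / 2 ^ p.1) : ℝ) = 6 * (n / 2 ^ p.1) := by ring
    refine ⟨by rw [h4]; linarith, fun y hy => ?_⟩
    refine (hWp (a p) (haE p) (π x) (hπE x) y).trans ?_
    rw [mul_assoc, ← Real.mul_rpow (by norm_num) hδ0.le]
    refine mul_le_mul_of_nonneg_left (Real.rpow_le_rpow (by positivity) ?_ hs.le) hW0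
    have h5 := hπ (latt p.1 p.2.1)
    have h6 := hπ x
    have h7 := norm_sub_le_norm_sub_add_norm_sub y (latt p.1 p.2.1) (a p)
    have h8 := norm_sub_le_norm_sub_add_norm_sub y (latt p.1 p.2.1) (π x)
    have h9 := norm_sub_le_norm_sub_add_norm_sub (latt p.1 p.2.1) z (π x)
    have h10 := norm_sub_le_norm_sub_add_norm_sub z x (π x)
    rw [norm_sub_rev] at h3
    rw [norm_sub_rev] at e3
    linarith
  set V : EuclideanSpace ℝ (Fin n) → EuclideanSpace ℝ (Fin m) := fun y =>
    ∑ p ∈ I, whitneyFun E p y • (pol (a p) y - pol (π x) y) with hV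
  have hVapprox : JetApprox d s C3 V := by
    have h1 : JetApprox d s (I.card * (A * (W * 20 ^ s) * (6 * n) ^ s)) V := by
      refine JetApprox.sum fun p hp => ?_
      obtain ⟨h2, h3⟩ := hgeom p hp
      set b := latt p.1 p.2.1 with hb
      set c := shiftJet d (P (a p)) (b - a p) - shiftJet d (P (π x)) (b - π x) with hc
      have hcy : ∀ y, jetEval d c (y - b) = pol (a p) y - pol (π x) y := fun y => by
        rw [hc, jetEval_sub, jetEval_shiftJet, jetEval_shiftJet, hpol,
          show b - a p + (y - b) = y - a p by abel, show b - π x + (y - b) = y - π x by abel]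
      have h4 := hA (fun j => p.2.2 j - 2 * p.2.1 j) b c (2 ^ p.1) (W * 20 ^ s * δ ^ s)
        (by positivity) (fun v hv => ?_)
      · have h5 := (h4.const_smul (sel E p.1 p.2.1 - sel E (p.1 + 1) p.2.2)).mono_const
          (C' := A * (W * 20 ^ s) * (6 * n) ^ s) ?_
        · convert h5 using 2 with y
          rw [smul_smul, ← whitneyFun_eq_kern, hcy]
        · have h6 : δ ^ s * (2 ^ p.1 : ℝ) ^ s ≤ (6 * n) ^ s := by
            rw [← Real.mul_rpow hδ0.le (by positivity)]
            refine Real.rpow_le_rpow (by positivity) ?_ hs.le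
            calc δ * 2 ^ p.1 ≤ (6 * n * (1 / 2 ^ p.1)) * 2 ^ p.1 := by gcongr
              _ = 6 * n := by field_simp
          have h7 := abs_sel_sub_sel_le E p.1 (p.1 + 1) p.2.1 p.2.2
          calc _ ≤ 1 * (A * (W * 20 ^ s * δ ^ s) * (2 ^ p.1 : ℝ) ^ s) := by gcongr
            _ = A * (W * 20 ^ s) * (δ ^ s * (2 ^ p.1 : ℝ) ^ s) := by ring
            _ ≤ _ := by gcongr
      · have h5 := hcy (b + v)
        rw [add_sub_cancel_left] at h5
        rw [h5]
        refine h3 _ ?_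
        rw [add_sub_cancel_left]
        refine hv.le.trans ?_
        rw [inv_eq_one_div]
        gcongr
    refine h1.mono_const ?_
    rw [hC3]
    gcongr
  have hVbd : ∀ y, ‖V y‖ ≤ C4 * δ ^ s := by
    intro y
    refine (norm_sum_le _ _).trans ?_
    have hterm : ∀ p ∈ I, ‖whitneyFun E p y • (pol (a p) y - pol (π x) y)‖
        ≤ W * 20 ^ s * δ ^ s := by
      intro p hp
      by_cases h0 : whitneyFun E p y = 0
      · rw [h0, zero_smul, norm_zero]
        positivity
      · rw [norm_smul, Real.norm_eq_abs, ← one_mul (W * 20 ^ s * δ ^ s)]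
        exact mul_le_mul (abs_whitneyFun_le_one E p y)
          ((hgeom p hp).2 y (norm_sub_latt_le_of_whitneyFun_ne_zero h0)) (norm_nonneg _)
          zero_le_one
    calc _ ≤ I.card • (W * 20 ^ s * δ ^ s) := sum_le_card_nsmul _ _ _ hterm
      _ ≤ C4 * δ ^ s := by
        rw [nsmul_eq_mul, ← mul_assoc, hC4]
        gcongr
  obtain ⟨c, hc⟩ := hVapprox x
  refine ⟨shiftJet d (P (π x)) (x - π x) + c, fun y => ?_⟩
  have h1 : jetEval d (shiftJet d (P (π x)) (x - π x) + c) (y - x)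
      = pol (π x) y + jetEval d c (y - x) := by
    rw [jetEval_add, jetEval_shiftJet, hpol, show x - π x + (y - x) = y - π x by abel]
  have h2 : ‖u y - pol (π x) y - V y‖ ≤ C5 * ‖y - x‖ ^ s := by
    -- Within `δ / (6 * n)` of `x` only members of `I` are active and the difference is zero.
    -- Farther away `δ ≤ 6 * n * |y - x|`, and the size bounds on both terms suffice.
    rcases le_or_gt ‖y - x‖ (δ / (6 * n)) with hyx | hyx
    · have hyE : y ∉ E := fun hy => by
        have h3 : δ ≤ ‖y - x‖ := by
          rw [norm_sub_rev, ← dist_eq_norm]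
          exact Metric.infDist_le_dist_of_mem hy
        have h4 : δ / (6 * n) < δ := div_lt_self hδ0 (by linarith)
        linarith
      rw [huI y hyE I fun p hp => (hI p).1 ⟨y, hyx, hp⟩, hV, sub_self, norm_zero]
      positivity
    · have hδy : δ ≤ 6 * n * ‖y - x‖ := by
        rw [div_lt_iff₀ (by positivity)] at hyx
        linarith
      have h3 := hmain (π x) (hπE x) y
      have h4 : ‖y - π x‖ ^ s ≤ (1 + 6 * n) ^ s * ‖y - x‖ ^ s := by
        rw [← Real.mul_rpow (by positivity) (norm_nonneg _)]
        refine Real.rpow_le_rpow (norm_nonneg _) ?_ hs.le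
        have h5 := norm_sub_le_norm_sub_add_norm_sub y x (π x)
        rw [hπ x] at h5
        linarith
      have h5 : δ ^ s ≤ (6 * n) ^ s * ‖y - x‖ ^ s := by
        rw [← Real.mul_rpow (by positivity) (norm_nonneg _)]
        exact Real.rpow_le_rpow hδ0.le hδy hs.le
      calc _ ≤ ‖u y - pol (π x) y‖ + ‖V y‖ := norm_sub_le _ _
        _ ≤ C1 * ((1 + 6 * n) ^ s * ‖y - x‖ ^ s) + C4 * ((6 * n) ^ s * ‖y - x‖ ^ s) :=
          add_le_add (h3.trans (by gcongr)) ((hVbd y).trans (by gcongr))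
        _ = C5 * ‖y - x‖ ^ s := by rw [hC5]; ring
  have h3 := hc y
  rw [h1]
  have h4 : u y - (pol (π x) y + jetEval d c (y - x))
      = (u y - pol (π x) y - V y) + (V y - jetEval d c (y - x)) := by abel
  rw [h4]
  refine (norm_add_le _ _).trans ?_
  have h5 : 0 ≤ C1 * ‖y - x‖ ^ s := by positivity
  linarith

theorem continuous_jetEval_comp {T : Type*} [TopologicalSpace T] {n : ℕ} {F : Type*}
    [NormedAddCommGroup F] [NormedSpace ℝ F] {d : ℕ} {a : T → (Fin n → ℕ) → F}
    {v : T → EuclideanSpace ℝ (Fin n)} (ha : Continuous a) (hv : Continuous v) :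
    Continuous fun e => jetEval d (a e) (v e) := by
  unfold jetEval
  exact continuous_finsetSum _ fun α _ =>
    ((continuous_mono α).comp hv).smul ((continuous_apply α).comp ha)

/-- The compatibility of a set of jets passes to its closure. -/
theorem jetCompat_closure {n : ℕ} {F : Type*} [NormedAddCommGroup F] [NormedSpace ℝ F] {d : ℕ}
    {s W : ℝ} (hs : 0 ≤ s) {R : Set (EuclideanSpace ℝ (Fin n) × ((Fin n → ℕ) → F))}
    (h : ∀ p ∈ R, ∀ p' ∈ R, ∀ y, ‖jetEval d p.2 (y - p.1) - jetEval d p'.2 (y - p'.1)‖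
      ≤ W * (‖y - p.1‖ + ‖y - p'.1‖) ^ s) :
    ∀ p ∈ closure R, ∀ p' ∈ closure R, ∀ y,
      ‖jetEval d p.2 (y - p.1) - jetEval d p'.2 (y - p'.1)‖
        ≤ W * (‖y - p.1‖ + ‖y - p'.1‖) ^ s := by
  have hstep : ∀ (p' : EuclideanSpace ℝ (Fin n) × ((Fin n → ℕ) → F)) (y : EuclideanSpace ℝ (Fin n)),
      IsClosed {p : EuclideanSpace ℝ (Fin n) × ((Fin n → ℕ) → F) |
        ‖jetEval d p.2 (y - p.1) - jetEval d p'.2 (y - p'.1)‖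
          ≤ W * (‖y - p.1‖ + ‖y - p'.1‖) ^ s} := fun p' y =>
    isClosed_le
      (((continuous_jetEval_comp continuous_snd (continuous_const.sub continuous_fst)).sub continuous_const).norm)
      (continuous_const.mul (((continuous_const.sub continuous_fst).norm.add
        continuous_const).rpow_const fun _ => Or.inr hs))
  have h1 : ∀ p' ∈ R, ∀ p ∈ closure R, ∀ y,
      ‖jetEval d p.2 (y - p.1) - jetEval d p'.2 (y - p'.1)‖
        ≤ W * (‖y - p.1‖ + ‖y - p'.1‖) ^ s := fun p' hp' p hp y =>
    closure_minimal (fun p₀ hp₀ => h p₀ hp₀ p' hp' y) (hstep p' y) hp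
  intro p hp p' hp' y
  have h2 := closure_minimal (fun p₀ hp₀ => ?_) (hstep p y) hp'
  · rw [Set.mem_ofPred_eq, norm_sub_rev, add_comm ‖y - p'.1‖] at h2
    exact h2
  · rw [Set.mem_ofPred_eq, norm_sub_rev, add_comm ‖y - p₀.1‖]
    exact h1 p₀ hp₀ p hp y

/-- A bounded family of jets on an arbitrary small set, compatible to order `d + t`, is the family
of jets of a function of class `C^{d,t}`. -/
theorem exists_isCHolder_extension {n : ℕ} (hn : 0 < n) {m d : ℕ} {t : ℝ} (ht : 0 < t)
    (ht1 : t ≤ 1) {S : Set (EuclideanSpace ℝ (Fin n))} {q : EuclideanSpace ℝ (Fin n)}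
    (hS : ∀ x ∈ S, ‖x - q‖ ≤ 1 / 4)
    {c : EuclideanSpace ℝ (Fin n) → (Fin n → ℕ) → EuclideanSpace ℝ (Fin m)} {M W : ℝ}
    (hM : 0 ≤ M) (hc : ∀ x ∈ S, ∀ α, ‖c x α‖ ≤ M) (hW0 : 0 ≤ W)
    (hW : ∀ x ∈ S, ∀ z ∈ S, ∀ y, ‖jetEval d (c x) (y - x) - jetEval d (c z) (y - z)‖
      ≤ W * (‖y - x‖ + ‖y - z‖) ^ ((d : ℝ) + t)) :
    ∃ g : EuclideanSpace ℝ (Fin n) → EuclideanSpace ℝ (Fin m), IsCHolder d t g ∧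
      ∀ x ∈ S, ∀ α : Fin n → ℕ, ∑ i, α i ≤ d → multiDeriv α g x = c x α := by
  classical
  have hs : 0 < (d : ℝ) + t := by positivity
  set s := (d : ℝ) + t with hsdef
  -- Taking the closure of the set of jets, not only of `S`, supplies compatible jets at the limit
  -- points of `S`. Bounded coefficients make this closure compact, so its projection `E₁` is
  -- closed.
  set R₀ : Set (EuclideanSpace ℝ (Fin n) × ((Fin n → ℕ) → EuclideanSpace ℝ (Fin m))) :=
    (fun x => (x, c x)) '' S with hR₀
  set R := closure R₀ with hR
  set Q : Set (EuclideanSpace ℝ (Fin n) × ((Fin n → ℕ) → EuclideanSpace ℝ (Fin m))) :=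
    Metric.closedBall q (1 / 4) ×ˢ Set.univ.pi fun _ => Metric.closedBall 0 M with hQ
  have hQc : IsCompact Q :=
    (isCompact_closedBall q _).prod (isCompact_univ_pi fun _ => isCompact_closedBall 0 M)
  have hRQ : R ⊆ Q := by
    refine closure_minimal ?_ hQc.isClosed
    rintro _ ⟨x, hx, rfl⟩
    refine ⟨by simpa [dist_eq_norm] using hS x hx, fun α _ => ?_⟩
    simpa using hc x hx α
  have hRW : ∀ p ∈ R, ∀ p' ∈ R, ∀ y, ‖jetEval d p.2 (y - p.1) - jetEval d p'.2 (y - p'.1)‖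
      ≤ W * (‖y - p.1‖ + ‖y - p'.1‖) ^ s := by
    refine jetCompat_closure hs.le ?_
    rintro _ ⟨x, hx, rfl⟩ _ ⟨z, hz, rfl⟩ y
    exact hW x hx z hz y
  set E₁ : Set (EuclideanSpace ℝ (Fin n)) := Prod.fst '' R with hE₁
  -- Prescribing the zero jet away from `q` makes the extension bounded and puts every point within
  -- distance one of the closed set.
  set E₂ : Set (EuclideanSpace ℝ (Fin n)) := {x | 1 / 2 ≤ ‖x - q‖} with hE₂
  have hSE : S ⊆ E₁ := fun x hx => ⟨(x, c x), subset_closure ⟨x, hx, rfl⟩, rfl⟩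
  have hE₁q : ∀ x ∈ E₁, ‖x - q‖ ≤ 1 / 4 := by
    rintro _ ⟨p, hp, rfl⟩
    simpa [dist_eq_norm] using (hRQ hp).1
  have hclosed : IsClosed (E₁ ∪ E₂) :=
    (((hQc.of_isClosed_subset isClosed_closure hRQ).image continuous_fst).isClosed).union
      (isClosed_le continuous_const (by fun_prop))
  have hfar : ∀ y : EuclideanSpace ℝ (Fin n), ∃ z ∈ E₂, ‖y - z‖ ≤ 1 := by
    intro y
    rcases le_or_gt (1 / 2) ‖y - q‖ with h | h
    · exact ⟨y, h, by simp⟩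
    · have h1 : ‖EuclideanSpace.single (⟨0, hn⟩ : Fin n) (1 / 2 : ℝ)‖ = 1 / 2 := by simp
      refine ⟨q + EuclideanSpace.single (⟨0, hn⟩ : Fin n) (1 / 2 : ℝ), ?_, ?_⟩
      · rw [hE₂, Set.mem_ofPred_eq, add_sub_cancel_left, h1]
      · rw [← sub_sub]
        refine (norm_sub_le _ _).trans ?_
        rw [h1]
        linarith
  have hex : ∀ x ∈ E₁, ∃ b, (x, b) ∈ R := by
    rintro _ ⟨p, hp, rfl⟩
    exact ⟨p.2, hp⟩
  choose! b hb using hex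
  set P : EuclideanSpace ℝ (Fin n) → (Fin n → ℕ) → EuclideanSpace ℝ (Fin m) := fun x =>
    if x ∈ S then c x else if x ∈ E₁ then b x else 0 with hP
  have hPR : ∀ x ∈ E₁, (x, P x) ∈ R := by
    intro x hx
    by_cases hxS : x ∈ S
    · simp only [hP, hxS, if_true]
      exact subset_closure ⟨x, hxS, rfl⟩
    · simp only [hP, hxS, hx, if_true, if_false]
      exact hb x hx
  have hPS : ∀ x ∈ S, P x = c x := fun x hx => by simp only [hP, hx, if_true]
  have hPfar : ∀ x ∈ E₂, P x = 0 := by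
    intro x hx
    have h1 : x ∉ E₁ := fun h => by
      have h2 : 1 / 2 ≤ ‖x - q‖ := hx
      linarith [hE₁q x h]
    have h2 : x ∉ S := fun h => h1 (hSE h)
    simp only [hP, h1, h2, if_false]
  set W' := (multiIdx n d).card * (4 ^ s * M) with hW'
  have hW'0 : 0 ≤ W' := by positivity
  -- Points of `E₁` and `E₂` are at least `1 / 4` apart, so compatibility with the zero jet needs
  -- only the coefficient bound, read at scale `1 / 4`. As four times the right-hand distance sum is
  -- at least one, its power `d` is at most its power `s`.
  have hmixed : ∀ x ∈ E₁, ∀ z ∈ E₂, ∀ y, ‖jetEval d (P x) (y - x)‖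
      ≤ W' * (‖y - x‖ + ‖y - z‖) ^ s := by
    intro x hx z hz y
    have h1 : 1 / 4 ≤ ‖y - x‖ + ‖y - z‖ := by
      have h2 : 1 / 2 ≤ ‖z - q‖ := hz
      have h3 := hE₁q x hx
      have h4 := norm_sub_le_norm_sub_add_norm_sub z y q
      have h5 := norm_sub_le_norm_sub_add_norm_sub y x q
      rw [norm_sub_rev z y] at h4
      linarith
    have h2 := norm_jetEval_le_of_coeff (d := d) (c := P x) (v := y - x) (r := 1 / 4) (M := M)
      (by norm_num) h1 (le_add_of_nonneg_right (norm_nonneg _)) fun α _ => by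
        have h3 : ‖P x α‖ ≤ M := by
          simpa using (hRQ (hPR x hx)).2 α (Set.mem_univ α)
        refine (mul_le_of_le_one_right (norm_nonneg _) ?_).trans h3
        exact pow_le_one₀ (by norm_num) (by norm_num)
    refine h2.trans ?_
    rw [hW', mul_assoc]
    refine mul_le_mul_of_nonneg_left ?_ (Nat.cast_nonneg _)
    have h3 : ((‖y - x‖ + ‖y - z‖) / (1 / 4)) ^ d ≤ 4 ^ s * (‖y - x‖ + ‖y - z‖) ^ s := by
      rw [← Real.mul_rpow (by norm_num) (by positivity), ← Real.rpow_natCast,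
        show (‖y - x‖ + ‖y - z‖) / (1 / 4) = 4 * (‖y - x‖ + ‖y - z‖) by ring]
      exact Real.rpow_le_rpow_of_exponent_le (by linarith) (by linarith)
    calc _ ≤ (4 ^ s * (‖y - x‖ + ‖y - z‖) ^ s) * M := by gcongr
      _ = _ := by ring
  have hE1 : ∀ y, Metric.infDist y (E₁ ∪ E₂) ≤ 1 := by
    intro y
    obtain ⟨z, hz, hyz⟩ := hfar y
    rw [← dist_eq_norm] at hyz
    exact (Metric.infDist_le_dist_of_mem (Set.mem_union_right E₁ hz)).trans hyz
  have hcompat : ∀ x ∈ E₁ ∪ E₂, ∀ z ∈ E₁ ∪ E₂, ∀ y,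
      ‖jetEval d (P x) (y - x) - jetEval d (P z) (y - z)‖
        ≤ (W + W') * (‖y - x‖ + ‖y - z‖) ^ s := by
    intro x hx z hz y
    have h0 : 0 ≤ (‖y - x‖ + ‖y - z‖) ^ s := by positivity
    rcases hx with hx | hx <;> rcases hz with hz | hz
    · refine (hRW _ (hPR x hx) _ (hPR z hz) y).trans ?_
      gcongr
      linarith
    · rw [hPfar z hz, jetEval_zero, sub_zero]
      refine (hmixed x hx z hz y).trans ?_
      gcongr
      linarith
    · rw [hPfar x hx, jetEval_zero, zero_sub, norm_neg]
      refine (hmixed z hz x hx y).trans ?_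
      rw [add_comm ‖y - z‖]
      gcongr
      linarith
    · rw [hPfar x hx, hPfar z hz, jetEval_zero, jetEval_zero, sub_zero, norm_zero]
      positivity
  obtain ⟨u, C, hC0, hu1, hu2⟩ := exists_whitney_extension hn m d hs (by linarith) (by linarith)
    hclosed ((hfar 0).imp fun z hz => Or.inr hz.1) hE1 (add_nonneg hW0 hW'0) hcompat
  choose a ha using hu2
  have hall : ∀ x y, ‖u y - jetEval d (if x ∈ S then c x else a x) (y - x)‖
      ≤ C * ‖y - x‖ ^ s := by
    intro x y
    by_cases hx : x ∈ S
    · simp only [hx, if_true]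
      have h1 := hu1 x (Or.inl (hSE hx)) y
      rwa [hPS x hx] at h1
    · simp only [hx, if_false]
      exact ha x y
  refine ⟨u, isCHolder_of_forall_approx ht ht1 hC0 hall (M := C) fun y => ?_, fun x hx α hα => ?_⟩
  · obtain ⟨z, hz, hyz⟩ := hfar y
    have h1 := hu1 z (Or.inr hz) y
    rw [hPfar z hz, jetEval_zero, sub_zero] at h1
    exact h1.trans (mul_le_of_le_one_right hC0 (Real.rpow_le_one (norm_nonneg _) hyz hs.le))
  · rw [multiDeriv_eq_coeff ht hC0 hall hα]
    simp only [hx, if_true]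

/-! ### From approximate Taylor polynomials to the Hölder decomposition. -/

theorem ApproxDifferentiableAt.exists_isApproxTaylorPoly {n m : ℕ}
    {f : EuclideanSpace ℝ (Fin n) → EuclideanSpace ℝ (Fin m)} {k : ℕ} (hk : 0 < k)
    {x : EuclideanSpace ℝ (Fin n)} (h : ApproxDifferentiableAt f k x) :
    ∃ c, IsApproxTaylorPoly f (k - 1) (k : ℝ) x c := by
  obtain ⟨c, hc⟩ := h
  -- The discarded terms of degree `k` add at most the sum of the norms of the coefficients to the
  -- quotient, hence this threshold.
  refine ⟨c, isApproxTaylorPoly_iff.2 ⟨1 + ∑ α ∈ multiIdx n k, ‖c α‖, (hc 1 one_pos).mono ?_⟩⟩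
  intro y hy
  rw [Set.mem_ofPred_eq] at hy ⊢
  have hB0 : 0 ≤ ∑ α ∈ multiIdx n k, ‖c α‖ := sum_nonneg fun _ _ => norm_nonneg _
  rw [Real.rpow_natCast] at hy
  beta_reduce
  rw [sub_zero, centeredPoly_eq_jetEval]
  refine le_trans ?_ (le_abs_self _)
  rcases eq_or_ne y x with rfl | hne
  · rw [sub_self, norm_zero, zero_pow hk.ne', div_zero] at hy
    linarith
  have hr : 0 < ‖y - x‖ := norm_pos_iff.2 (sub_ne_zero.2 hne)
  have hsub : multiIdx n (k - 1) ⊆ multiIdx n k := fun α hα => by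
    have := mem_multiIdx.1 hα
    exact mem_multiIdx.2 (by omega)
  have h1 : ‖jetEval k c (y - x) - jetEval (k - 1) c (y - x)‖
      ≤ (∑ α ∈ multiIdx n k, ‖c α‖) * ‖y - x‖ ^ k := by
    rw [jetEval, jetEval, ← sum_sdiff hsub, add_sub_cancel_right]
    refine (norm_sum_le _ _).trans ?_
    rw [sum_mul]
    calc _ ≤ ∑ α ∈ multiIdx n k \ multiIdx n (k - 1), ‖c α‖ * ‖y - x‖ ^ k := by
          refine sum_le_sum fun α hα => ?_
          rw [Finset.mem_sdiff, mem_multiIdx, mem_multiIdx] at hα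
          have h2 : ∑ i, α i = k := by omega
          rw [norm_smul, mul_comm, ← h2]
          exact mul_le_mul_of_nonneg_left (abs_mono_le α _) (norm_nonneg _)
      _ ≤ _ := sum_le_sum_of_subset_of_nonneg sdiff_subset fun _ _ _ => by positivity
  rw [le_div_iff₀ (by positivity)] at hy ⊢
  have h3 := norm_sub_le_norm_sub_add_norm_sub (f y) (jetEval k c (y - x))
    (jetEval (k - 1) c (y - x))
  linarith

/-- The decomposition for approximate Taylor polynomials of order `d + t`. -/
theorem hasHolderDecomposition_of_isApproxTaylorPoly {n m : ℕ} (hn : 0 < n)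
    {f : EuclideanSpace ℝ (Fin n) → EuclideanSpace ℝ (Fin m)} {d : ℕ} {t : ℝ} (ht : 0 < t)
    (ht1 : t ≤ 1) {N : Set (EuclideanSpace ℝ (Fin n))}
    (h : ∀ x ∉ N, ∃ c, IsApproxTaylorPoly f d ((d : ℝ) + t) x c) :
    HasHolderDecomposition f d ((d : ℝ) + t) t N := by
  classical
  have hs : 0 < (d : ℝ) + t := by positivity
  set s := (d : ℝ) + t with hsdef
  choose! c₀ hc₀ using h
  set c : EuclideanSpace ℝ (Fin n) → (Fin n → ℕ) → EuclideanSpace ℝ (Fin m) := fun x α =>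
    if α ∈ multiIdx n d then c₀ x α else 0 with hcdef
  have hcc : ∀ x (α : Fin n → ℕ), ∑ i, α i ≤ d → c x α = c₀ x α := fun x α hα =>
    if_pos (mem_multiIdx.2 hα)
  have hc : ∀ x ∉ N, ∃ l : ℝ,
      HasDensityZeroAt {y | l ≤ ‖f y - jetEval d (c x) (y - x)‖ / ‖y - x‖ ^ s} x := by
    intro x hx
    simp only [jetEval_congr (hcc x)]
    exact isApproxTaylorPoly_iff.1 (hc₀ x hx)
  obtain ⟨ε, hε, K, hK, hKbd⟩ := exists_two_point_bound hn m d hs.le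
  -- On `A j` the coefficient bound, the approximation constant and the range of radii depend on `j`
  -- alone. These sets need not be measurable, since the extension applies to arbitrary small sets.
  set A : ℕ → Set (EuclideanSpace ℝ (Fin n)) := fun j => {x | x ∉ N ∧ (∀ α, ‖c x α‖ ≤ j) ∧
    ∀ r : ℝ, 0 < r → r < 1 / (j + 1) →
      volume (Metric.ball x r ∩ {y | (j : ℝ) ≤ ‖f y - jetEval d (c x) (y - x)‖ / ‖y - x‖ ^ s})
        ≤ ε * volume (Metric.ball x r)} with hA
  have hAcover : ∀ x ∉ N, ∃ j, x ∈ A j := by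
    intro x hx
    obtain ⟨l, hl⟩ := hc x hx
    obtain ⟨r₀, hr₀, hr⟩ := hl.eventually_le hε
    obtain ⟨j₁, hj₁⟩ := exists_nat_ge (max l (∑ α ∈ multiIdx n d, ‖c x α‖))
    obtain ⟨j₂, hj₂⟩ := exists_nat_one_div_lt hr₀
    refine ⟨max j₁ j₂, hx, fun α => ?_, fun r hr0 hrj => ?_⟩
    · have h1 : ‖c x α‖ ≤ ∑ α ∈ multiIdx n d, ‖c x α‖ := by
        by_cases hα : α ∈ multiIdx n d
        · exact single_le_sum (f := fun α => ‖c x α‖) (fun _ _ => norm_nonneg _) hα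
        · have h2 : c x α = 0 := if_neg hα
          rw [h2, norm_zero]
          exact sum_nonneg fun _ _ => norm_nonneg _
      push_cast
      exact h1.trans ((le_max_right _ _).trans (hj₁.trans (le_max_left _ _)))
    · have h1 : r < r₀ := by
        refine (hrj.trans_le ?_).trans hj₂
        gcongr
        exact le_max_right _ _
      refine (measure_mono (Set.inter_subset_inter_right _ fun y hy => ?_)).trans (hr r hr0 h1)
      rw [Set.mem_ofPred_eq] at hy ⊢
      push_cast at hy
      exact ((le_max_left _ _).trans (hj₁.trans (le_max_left _ _))).trans hy
  have hpiece : ∀ (j : ℕ) (q : EuclideanSpace ℝ (Fin n)),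
      ∃ g : EuclideanSpace ℝ (Fin n) → EuclideanSpace ℝ (Fin m), IsCHolder d t g ∧
        ∀ x ∈ A j ∩ Metric.ball q (1 / (4 * (j + 1))), ∀ α : Fin n → ℕ, ∑ i, α i ≤ d →
          multiDeriv α g x = c x α := by
    intro j q
    have hj0 : (0 : ℝ) ≤ j := Nat.cast_nonneg j
    have hsmall : (1 : ℝ) / (4 * (j + 1)) ≤ 1 / 4 :=
      div_le_div_of_nonneg_left zero_le_one (by norm_num) (by linarith)
    refine exists_isCHolder_extension hn ht ht1 (q := q) (M := j)
      (W := (multiIdx n d).card * (K * j)) (fun x hx => ?_) hj0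
      (fun x hx α => hx.1.2.1 α) (by positivity) ?_
    · have h1 := hx.2
      rw [Metric.mem_ball, dist_eq_norm] at h1
      linarith
    · intro x hx z hz y
      rcases eq_or_ne x z with rfl | hne
      · rw [sub_self, norm_zero]
        positivity
      have hr : 0 < ‖x - z‖ := norm_pos_iff.2 (sub_ne_zero.2 hne)
      -- The ball radius `1 / (4 * (j + 1))` is chosen for this: the density bounds of `A j` are
      -- available at the radii `|x - z|` and `2 * |x - z|`.
      have hxz : 2 * ‖x - z‖ < 1 / (j + 1) := by
        have h1 := hx.2
        have h2 := hz.2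
        rw [Metric.mem_ball, dist_eq_norm] at h1 h2
        have h3 := norm_sub_le_norm_sub_add_norm_sub x q z
        rw [norm_sub_rev q z] at h3
        have h4 : (1 : ℝ) / (j + 1) = 4 * (1 / (4 * (j + 1))) := by field_simp
        rw [h4]
        linarith
      have h1 := hKbd f x z (c x) (c z) ‖x - z‖ j hr le_rfl hj0
        (hx.1.2.2 _ hr (by linarith)) (hz.1.2.2 _ (by positivity) hxz)
      have h2 : ‖x - z‖ ≤ ‖y - x‖ + ‖y - z‖ := by
        have h3 := norm_sub_le_norm_sub_add_norm_sub x y z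
        rwa [norm_sub_rev x y] at h3
      have h3 := norm_jetEval_le_of_coeff hr h2
        (le_add_of_nonneg_right (norm_nonneg _) : ‖y - x‖ ≤ ‖y - x‖ + ‖y - z‖) h1
      rw [jetEval_sub, jetEval_shiftJet, show x - z + (y - x) = y - z by abel] at h3
      refine h3.trans ?_
      rw [mul_assoc]
      refine mul_le_mul_of_nonneg_left ?_ (Nat.cast_nonneg _)
      -- The coefficients are controlled at scale `r = |x - z|`. With `R = |y - x| + |y - z| ≥ r`,
      -- passing to `y` costs `(R / r) ^ d ≤ (R / r) ^ s`, which turns `r ^ s` into `R ^ s`.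
      have h4 : ((‖y - x‖ + ‖y - z‖) / ‖x - z‖) ^ d * ‖x - z‖ ^ s
          ≤ (‖y - x‖ + ‖y - z‖) ^ s := by
        have h5 : ((‖y - x‖ + ‖y - z‖) / ‖x - z‖) ^ d
            ≤ ((‖y - x‖ + ‖y - z‖) / ‖x - z‖) ^ s := by
          rw [← Real.rpow_natCast]
          exact Real.rpow_le_rpow_of_exponent_le ((one_le_div hr).2 h2) (by linarith)
        calc _ ≤ ((‖y - x‖ + ‖y - z‖) / ‖x - z‖) ^ s * ‖x - z‖ ^ s := by gcongr
          _ = _ := by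
            rw [← Real.mul_rpow (by positivity) hr.le, div_mul_cancel₀ _ hr.ne']
      calc _ = K * j * (((‖y - x‖ + ‖y - z‖) / ‖x - z‖) ^ d * ‖x - z‖ ^ s) := by ring
        _ ≤ _ := by gcongr
  choose g hg1 hg2 using hpiece
  set q := TopologicalSpace.denseSeq (EuclideanSpace ℝ (Fin n)) with hq
  refine ⟨fun k => A k.unpair.1 ∩ Metric.ball (q k.unpair.2) (1 / (4 * (k.unpair.1 + 1))),
    fun k => g k.unpair.1 (q k.unpair.2), ?_, fun k => ⟨hg1 _ _, fun x hx => ?_⟩⟩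
  · ext x
    rw [Set.mem_iUnion, Set.mem_compl_iff]
    constructor
    · rintro ⟨k, hk⟩
      exact hk.1.1
    · intro hx
      obtain ⟨j, hj⟩ := hAcover x hx
      obtain ⟨l, hl⟩ := (TopologicalSpace.denseRange_denseSeq
        (EuclideanSpace ℝ (Fin n))).exists_dist_lt x
        (by positivity : (0 : ℝ) < 1 / (4 * ((j : ℝ) + 1)))
      refine ⟨Nat.pair j l, ?_⟩
      rw [Nat.unpair_pair]
      exact ⟨hj, hl⟩
  · have hxN : x ∉ N := hx.1.1
    refine ⟨⟨c₀ x, hc₀ x hxN⟩, fun c' hc' α hα => ?_⟩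
    rw [hg2 _ _ x hx α hα, hcc x α hα]
    exact hc'.coeff_eq hn (by linarith) (hc₀ x hxN) hα

end

theorem mainTheorem6 {n m : ℕ} (hn : 0 < n)
    (f : EuclideanSpace ℝ (Fin n) → EuclideanSpace ℝ (Fin m))
    (hf : NullMeasurable f volume) (k : ℕ) (hk : 0 < k)
    (N : Set (EuclideanSpace ℝ (Fin n))) :
    ((∀ x ∉ N, ApproxDifferentiableAt f k x) →
      ∀ x ∉ N, ∃ c, IsApproxTaylorPoly f (k - 1) (k : ℝ) x c) ∧
    ((∀ x ∉ N, ∃ c, IsApproxTaylorPoly f (k - 1) (k : ℝ) x c) →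
      HasHolderDecomposition f (k - 1) (k : ℝ) 1 N) ∧
    (∀ t : ℝ, 0 < t → t ≤ 1 →
      (∀ x ∉ N, ∃ c, IsApproxTaylorPoly f (k - 1) ((k : ℝ) - 1 + t) x c) →
      HasHolderDecomposition f (k - 1) ((k : ℝ) - 1 + t) t N) := by
  have hcast : ((k - 1 : ℕ) : ℝ) = (k : ℝ) - 1 := by
    rw [Nat.cast_sub hk, Nat.cast_one]
  have hB : ∀ t : ℝ, 0 < t → t ≤ 1 →
      (∀ x ∉ N, ∃ c, IsApproxTaylorPoly f (k - 1) ((k : ℝ) - 1 + t) x c) →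
      HasHolderDecomposition f (k - 1) ((k : ℝ) - 1 + t) t N := by
    intro t ht ht1 h
    rw [← hcast] at h ⊢
    exact hasHolderDecomposition_of_isApproxTaylorPoly hn ht ht1 h
  refine ⟨fun h x hx => (h x hx).exists_isApproxTaylorPoly hk, fun h => ?_, hB⟩
  -- (ii) ⇒ (iii) is (B) with `t = 1`.
  have h1 := hB 1 one_pos le_rfl
  rw [sub_add_cancel] at h1
  exact h1 h
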